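/- **Setting.** Let $G=(V,E)$ be a finite 2-edge-connected multigraph (connected, and still connected after deleting any one edge), let $s,t\in V$, and let $k\ge 2$. Let $H$ be a spanning subgraph of $G$. Then $H$ is *feasible for SD-$k$-RSND* if for every $F\subseteq E$ with $|F|<k$ such that $G\setminus F$ has an $s$–$t$ path, $H\setminus F$ also has an $s$–$t$ path. For vertex sets $X,Y$ and $d\ge 0$, a spanning subgraph $H'$ of a graph $G'$ *satisfies the demand $(X,Y,d)$ on $G'$* if for every set $F$ of edges of $G'$ with $|F|<d$: if $G'\setminus F$ has a path from some vertex of $X$ to some vertex of $Y$, then so does $H'\setminus F$. **Important separators.** An $(X,Y)$-separator of a graph is a set $S$ of its edges such that no path joins $X$ to $Y$ after deleting $S$. It is minimal if no proper subset is an $(X,Y)$-separator. Write $R_S$ for the set of vertices reachable from $X$ after deleting $S$. A minimal separator $S$ is *important* if there is no $(X,Y)$-separator $S'$ with $|S'|\le|S|$ and $R_{S'}\subsetneq R_S$. **Chains.** An $(X,Y)$ $h$-chain of a graph $G'$ is obtained as follows. Put $V_{(0,\ell)}=X$. For $i=0,1,\dots$, let $W_i$ be the set of vertices of $G'$ outside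 $R_0\cup\dots\cup R_{i-1}$. If $G'[W_i]$ has no important $(V_{(i,\ell)},Y)$-separator of size $h$, put $R_i=W_i$, $V_{(i,r)}=Y$ and stop. Otherwise choose such a separator $S_i$; let $R_i$ be the set of vertices reachable from $V_{(i,\ell)}$ in $G'[W_i]\setminus S_i$; let $V_{(i,r)}$ and $V_{(i+1,\ell)}$ be the sets of vertices incident on $S_i$ in $R_i$ and in $W_i\setminus R_i$ respectively; and continue. The left separator of $R_{i+1}$ and the right separator of $R_i$ are both $S_i$. **Hierarchical $k$-chain decomposition.** The unique $1$-component is $V$, with $V_\ell=\{s\}$, $V_r=\{t\}$ and empty left and right separators. For $1\le h<k-1$, every $h$-component $R$, with boundary sets $V_\ell,V_r$, is replaced by the components of some $(V_\ell,V_r)$ $(h+1)$-chain of $G[R]$. The first of these inherits the left boundary set and left separator of $R$, and the last inherits its right boundary set and right separator. The resulting $h$-components, ordered from left to right, are $R^h_0,R^h_1,\dots$ for $1\le h\le k-1$. The component $R^h_i$ has boundary sets $V^h_{(i,\ell)},V^h_{(i,r)}$, left separator $S^h_{i-1}$ and right separator $S^h_i$; the left separator of the first component and the right separator of the last one are empty.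 Let $S$ be the union of all these separators, over all $h$ and $i$. Put $G^h_i=G[R^h_i]$ and $H^h_i=H[R^h_i]$. For $X\subseteq V^h_{(i,\ell)}$ and $Y\subseteq V^h_{(i,r)}$, let $S_X$ be the set of edges of $S^h_{i-1}$ incident on $X$, and $S_Y$ the set of edges of $S^h_i$ incident on $Y$. **Theorem (Structure Theorem).** For every hierarchical $k$-chain decomposition of $G$ and every spanning subgraph $H$ of $G$: $H$ is feasible for SD-$k$-RSND if and only if $S\subseteq E(H)$ and, for every $1\le h\le k-1$ and every $h$-component $R^h_i$, the subgraph $H^h_i$ satisfies on $G^h_i$ all of the following demands: 1. $(X,Y,d)$ with $d=\max\bigl(0,\;k+|S_X|+|S_Y|-|S^h_{i-1}|-|S^h_i|\bigr)$, for all $X\subseteq V^h_{(i,\ell)}$ and $Y\subseteq V^h_{(i,r)}$ with $(X,Y)\ne\bigl(V^h_{(i,\ell)},V^h_{(i,r)}\bigr)$; 2. $\bigl(V^h_{(i,\ell)},V^h_{(i,r)},h+1\bigr)$; 3. $\bigl(V^h_{(i,\ell)},V^h_{(i,r)},k-1\bigr)$. -/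

import Mathlib

open scoped Graph

namespace RSND

/-! Multigraphs are Mathlib's `Graph α β`: vertices in `α`, edges in `β`, parallel edges and loops
allowed; `G.deleteEdges F` is `G ∖ F` and `G.induce R` is `G[R]`. -/

/-- There is a path (of length at least `0`) from `x` to `y` in `G`. -/
def Reachable {α β : Type*} (G : Graph α β) (x y : α) : Prop :=
  x ∈ V(G) ∧ Relation.ReflTransGen G.Adj x y

/-- There is a path in `G` from some vertex of `X` to some vertex of `Y`. -/
def Linked {α β : Type*} (G : Graph α β) (X Y : Set α) : Prop :=
  ∃ x ∈ X, ∃ y ∈ Y, Reachable G x y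

/-- The set of vertices of `G` reachable from some vertex of `X`. -/
def reachSet {α β : Type*} (G : Graph α β) (X : Set α) : Set α :=
  {v | ∃ x ∈ X, Reachable G x v}

/-- `G` is connected (and has at least one vertex). -/
def Connected {α β : Type*} (G : Graph α β) : Prop :=
  V(G).Nonempty ∧ ∀ x ∈ V(G), ∀ y ∈ V(G), Reachable G x y

/-- `G` is 2-edge-connected: it is connected and stays so after deleting any single edge. -/
def TwoEdgeConnected {α β : Type*} (G : Graph α β) : Prop :=
  Connected G ∧ ∀ e ∈ E(G), Connected (G.deleteEdges {e})

/-! ### Relative demands -/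

/-- `H` is a feasible solution to the single-demand relative survivable network design problem on
`G` with demand `(s, t, k)`. -/
def IsFeasibleSD {α β : Type*} (G H : Graph α β) (s t : α) (k : ℕ) : Prop :=
  ∀ F ⊆ E(G), F.ncard < k →
    Reachable (G.deleteEdges F) s t → Reachable (H.deleteEdges F) s t

/-- `H` satisfies the relative demand `(X, Y, d)` between vertex sets on input graph `G`. -/
def SatisfiesDemand {α β : Type*} (G H : Graph α β) (X Y : Set α) (d : ℕ) : Prop :=
  ∀ F ⊆ E(G), F.ncard < d →
    Linked (G.deleteEdges F) X Y → Linked (H.deleteEdges F) X Y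

/-! ### Important separators -/

/-- `S` is an `(X, Y)`-separator of `G`. -/
def IsSeparator {α β : Type*} (G : Graph α β) (X Y : Set α) (S : Set β) : Prop :=
  S ⊆ E(G) ∧ ¬ Linked (G.deleteEdges S) X Y

/-- `S` is an inclusion-minimal `(X, Y)`-separator of `G`. -/
def IsMinimalSeparator {α β : Type*} (G : Graph α β) (X Y : Set α) (S : Set β) : Prop :=
  IsSeparator G X Y S ∧ ∀ S' ⊂ S, ¬ IsSeparator G X Y S'

/-- `S` is an important `(X, Y)`-separator of `G`: it is minimal, and no separator of at most the
same size leaves a strictly smaller set of vertices reachable from `X`. -/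
def IsImportantSeparator {α β : Type*} (G : Graph α β) (X Y : Set α) (S : Set β) : Prop :=
  IsMinimalSeparator G X Y S ∧
    ∀ S', IsSeparator G X Y S' → S'.ncard ≤ S.ncard →
      ¬ reachSet (G.deleteEdges S') X ⊂ reachSet (G.deleteEdges S) X

/-! ### Chains and the hierarchical chain decomposition -/

/-- A component of a chain decomposition: its vertex set `R`, its left and right boundary vertex
sets `V_ℓ` and `V_r`, and the separators to its left and to its right. -/
structure Component (α β : Type*) where
  verts : Set α
  left : Set α
  right : Set α
  leftSep : Set β
  rightSep : Set β

/-- `IsChain G h C L`: the list `L` is a `(C.left, C.right)` `h`-chain of `G[C.verts]`, listed from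
left to right. If `G[C.verts]` has no important `(C.left, C.right)`-separator of size `h`, the chain
consists of `C` alone. Otherwise some such separator `S` is chosen; the first component has as its
vertices the set `R` reachable from `C.left` after deleting `S`, and the construction continues on
the remaining vertices, starting from the endpoints of `S` among them. The first component inherits
the left separator of `C`, the last one its right boundary and right separator. -/
inductive IsChain {α β : Type*} (G : Graph α β) (h : ℕ) :
    Component α β → List (Component α β) → Prop
  | last (C : Component α β)
      (hno : ¬ ∃ S : Set β,
        IsImportantSeparator (G.induce C.verts) C.left C.right S ∧ S.ncard = h) :
      IsChain G h C [C]
  | step (C : Component α β) (S : Set β) (R : Set α) (L : List (Component α β))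
      (hS : IsImportantSeparator (G.induce C.verts) C.left C.right S)
      (hcard : S.ncard = h)
      (hR : R = reachSet ((G.induce C.verts).deleteEdges S) C.left)
      (hL : IsChain G h
        { verts := C.verts \ R
          left := {v ∈ C.verts \ R | ∃ e ∈ S, G.Inc e v}
          right := C.right
          leftSep := S
          rightSep := C.rightSep } L) :
      IsChain G h C
        ({ verts := R
           left := C.left
           right := {v ∈ R | ∃ e ∈ S, G.Inc e v}
           leftSep := C.leftSep
           rightSep := S } :: L)

/-- The unique component of level `1`: all of `G`, with boundary sets `{s}` and `{t}` and with
empty left and right separators. -/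
def rootComponent {α β : Type*} (G : Graph α β) (s t : α) : Component α β where
  verts := V(G)
  left := {s}
  right := {t}
  leftSep := ∅
  rightSep := ∅

/-- A hierarchical `k`-chain decomposition of `G` with respect to `s, t`: `level h`, for
`1 ≤ h ≤ k - 1`, is the left-to-right list of the `h`-components, and every `h`-component with
`h < k - 1` is replaced at level `h + 1` by an `(h + 1)`-chain of it. -/
structure HierarchicalDecomposition {α β : Type*} (G : Graph α β) (s t : α) (k : ℕ) where
  level : ℕ → List (Component α β)
  level_one : level 1 = [rootComponent G s t]
  level_succ : ∀ h : ℕ, 1 ≤ h → h < k - 1 →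
    ∃ chains : List (List (Component α β)),
      List.Forall₂ (IsChain G (h + 1)) (level h) chains ∧ level (h + 1) = chains.flatten

/-- The set of all edges in the separators of the decomposition. -/
def HierarchicalDecomposition.separatorEdges {α β : Type*} {G : Graph α β} {s t : α} {k : ℕ}
    (D : HierarchicalDecomposition G s t k) : Set β :=
  {e | ∃ h : ℕ, 1 ≤ h ∧ h ≤ k - 1 ∧ ∃ C ∈ D.level h, e ∈ C.leftSep ∨ e ∈ C.rightSep}

/-- The edges of the set `S` that are incident on a vertex of `X`. -/
def incidentEdges {α β : Type*} (G : Graph α β) (S : Set β) (X : Set α) : Set β :=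
  {e ∈ S | ∃ x ∈ X, G.Inc e x}

/-- The demand value `max (0, k + |S_X| + |S_Y| - |S_left| - |S_right|)` for `X ⊆ V_ℓ`, `Y ⊆ V_r`
in the component `C`. -/
noncomputable def demandValue {α β : Type*} (G : Graph α β) (k : ℕ) (C : Component α β) (X Y : Set α) : ℕ :=
  (max 0 ((k : ℤ) + (incidentEdges G C.leftSep X).ncard + (incidentEdges G C.rightSep Y).ncard
    - C.leftSep.ncard - C.rightSep.ncard)).toNat

end RSND

open scoped Graph
namespace RSND

/-! ### Reachability and closed vertex sets -/

section Reachability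

variable {α β : Type*} {G G' : Graph α β} {x y z : α} {e : β} {B P X Y : Set α} {F T : Set β}

/-! Necessity. Suppose `F` lies inside a component, has fewer edges than the demand `(X, Y, d)`, and
leaves `X` and `Y` linked in `G`. Add to `F` the separator edges that miss `X` on the left or `Y` on
the right; by `lt_demandValue_iff` fewer than `k` edges are deleted in all. `G` still joins `s` to
`X` through the left part and `Y` to `t` through the right part, so `H` has an `s`–`t` path, which
must enter the component at `X` and leave it at `Y` (`IsFeasibleSD.linked`). For the full boundary
sets nothing is missed and the value is `k`, so demands 2 and 3 are weakenings. A separator edge is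
forced into `H` by deleting the rest of its separator.

Sufficiency. By downward induction on the level, every component satisfies the demand `k` between
its full boundary sets; the root component gives feasibility. For the step
(`IsChain.satisfiesDemand`), let fewer than `k` edges `F` separate the boundary sets of `C` in `H`,
and let `A` be the side reached from the left. Edges between chain components are separator edges,
hence in `H`; so it suffices that inside each chain component the edges of `G` outside `H` do not
lead from `A` to a boundary vertex outside `A` (`Slab.not_reachable`). The demands there fall short
of `k` by the number of missed separator edges. Since `H[C]` has no cut smaller than a separator of
the chain, these deficits can be charged to the cut edges of `A` outside the component
(`Slab.deficit_lt`). The hard case, two connections hanging on the same boundary set, is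
`Slab.not_reachable_of_left_left`.

The geometry behind this is an invariant: an `h`-component has no separator with at most `h` edges
between its boundary sets. Importance provides it, through `IsImportantSeparator.wellLinked_head`
and `exists_isImportantSeparator`. -/

lemma isLink_induce_deleteEdges :
    ((G.induce P).deleteEdges F).IsLink e x y ↔ (G.IsLink e x y ∧ x ∈ P ∧ y ∈ P) ∧ e ∉ F := by
  simp

lemma isLink_induce : (G.induce P).IsLink e x y ↔ G.IsLink e x y ∧ x ∈ P ∧ y ∈ P := by
  simp

lemma isLink_deleteEdges : (G.deleteEdges F).IsLink e x y ↔ G.IsLink e x y ∧ e ∉ F := by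
  simp

lemma Reachable.refl (hx : x ∈ V(G)) : Reachable G x x := ⟨hx, .refl⟩

lemma Reachable.tail (h : Reachable G x y) (hl : G.IsLink e y z) : Reachable G x z :=
  ⟨h.1, h.2.tail ⟨e, hl⟩⟩

/-- This replaces all handling of explicit paths: instead of taking the first or last vertex of a
path with some property, one exhibits a set closed under the edges. -/
lemma Reachable.mem_of_closed (h : Reachable G x y) (hx : x ∈ B)
    (hB : ∀ e a b, G.IsLink e a b → a ∈ B → b ∈ B) : y ∈ B := by
  obtain ⟨-, h⟩ := h
  induction h with
  | refl => exact hx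
  | tail _ hl ih => obtain ⟨e, hl⟩ := hl; exact hB e _ _ hl ih

lemma Reachable.right_mem (h : Reachable G x y) : y ∈ V(G) :=
  h.mem_of_closed h.1 fun _ _ _ hl _ ↦ hl.right_mem

lemma Reachable.trans (h : Reachable G x y) (h' : Reachable G y z) : Reachable G x z :=
  ⟨h.1, h.2.trans h'.2⟩

lemma Reachable.of_isLink (hl : G.IsLink e x y) : Reachable G x y :=
  (Reachable.refl hl.left_mem).tail hl

lemma Reachable.symm (h : Reachable G x y) : Reachable G y x := by
  refine h.mem_of_closed (B := {v | Reachable G v x}) (.refl h.1) fun e a b hl ha ↦ ?_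
  exact (Reachable.of_isLink hl.symm).trans ha

lemma Reachable.mono (h : Reachable G x y) (hx : x ∈ V(G'))
    (hl : ∀ e a b, G.IsLink e a b → G'.IsLink e a b) : Reachable G' x y :=
  h.mem_of_closed (B := {v | Reachable G' x v}) (.refl hx) fun e a b hab ha ↦
    Reachable.tail ha (hl e a b hab)

lemma Reachable.mono_of_closed (h : Reachable G x y) (hx : x ∈ V(G')) (hxB : x ∈ B)
    (hl : ∀ e a b, G.IsLink e a b → a ∈ B → b ∈ B ∧ G'.IsLink e a b) : Reachable G' x y :=
  (h.mem_of_closed (B := {v | v ∈ B ∧ Reachable G' x v}) ⟨hxB, .refl hx⟩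
    fun e a b hab ha ↦ ⟨(hl e a b hab ha.1).1, ha.2.tail (hl e a b hab ha.1).2⟩).2

lemma reachSet_subset (h : X ⊆ B) (hB : ∀ e a b, G.IsLink e a b → a ∈ B → b ∈ B) :
    reachSet G X ⊆ B := by
  rintro v ⟨x, hx, hr⟩
  exact hr.mem_of_closed (h hx) hB

lemma reachSet_closed (e a b) (hl : G.IsLink e a b) (ha : a ∈ reachSet G X) :
    b ∈ reachSet G X := by
  obtain ⟨x, hx, hr⟩ := ha
  exact ⟨x, hx, hr.tail hl⟩

lemma subset_reachSet (h : X ⊆ V(G)) : X ⊆ reachSet G X := fun x hx ↦ ⟨x, hx, .refl (h hx)⟩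

lemma reachSet_subset_vertexSet : reachSet G X ⊆ V(G) := fun _ ⟨_, _, hr⟩ ↦ hr.right_mem

lemma Linked.exists_mem_of_closed (h : Linked G X Y) (hX : X ⊆ B)
    (hB : ∀ e a b, G.IsLink e a b → a ∈ B → b ∈ B) : ∃ y ∈ Y, y ∈ B := by
  obtain ⟨x, hx, y, hy, hr⟩ := h
  exact ⟨y, hy, hr.mem_of_closed (hX hx) hB⟩

lemma not_linked_iff : ¬ Linked G X Y ↔ ∀ y ∈ Y, y ∉ reachSet G X := by
  simp only [Linked, reachSet, Set.mem_ofPred_eq]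
  grind

lemma Linked.symm (h : Linked G X Y) : Linked G Y X := by
  obtain ⟨x, hx, y, hy, hr⟩ := h
  exact ⟨y, hy, x, hx, hr.symm⟩

end Reachability

/-! ### Invariants of a component and its position in the graph -/

section Invariants

variable {α β : Type*} {G H : Graph α β} {s t : α} {C : Component α β} {U W : Set α} {c : ℕ}

/-- The component read from right to left. -/
def Component.rev (C : Component α β) : Component α β where
  verts := C.verts
  left := C.right
  right := C.left
  leftSep := C.rightSep
  rightSep := C.leftSep

/-- `G[C.verts]` has no separator of its boundary sets with fewer than `c` edges, and each vertex of
either boundary set is joined to the other one. -/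
structure WellLinked (G : Graph α β) (C : Component α β) (c : ℕ) : Prop where
  left_subset : C.left ⊆ C.verts
  right_subset : C.right ⊆ C.verts
  linked : ∀ T : Set β, T.Finite → T.ncard < c →
    Linked ((G.induce C.verts).deleteEdges T) C.left C.right
  left_reach : ∀ x ∈ C.left, ∃ y ∈ C.right, Reachable (G.induce C.verts) x y
  right_reach : ∀ y ∈ C.right, ∃ x ∈ C.left, Reachable (G.induce C.verts) x y

/-- `U` is the part of `G` to the left of the component `C`. -/
structure LeftPlaced (G : Graph α β) (s : α) (C : Component α β) (U : Set α) : Prop where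
  mem_leftSep : ∀ e, e ∈ C.leftSep ↔ ∃ x ∈ U, ∃ y ∈ C.verts, G.IsLink e x y
  mem_left : ∀ e x y, G.IsLink e x y → x ∈ U → y ∈ C.verts → y ∈ C.left
  source : s ∈ U ∨ C.left = {s}
  attached : ∀ x ∈ C.left, x = s ∨ ∃ u ∈ U, ∃ e, G.IsLink e u x
  reach : ∀ e x y, G.IsLink e x y → x ∈ U → y ∈ C.verts → Reachable (G.induce U) s x

/-- `U` and `W` are the parts of `G` to the left and to the right of the component `C`. -/
structure Placed (G : Graph α β) (s t : α) (C : Component α β) (U W : Set α) : Prop where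
  toLeft : LeftPlaced G s C U
  toRight : LeftPlaced G t C.rev W
  cover : ∀ v ∈ V(G), v ∈ U ∨ v ∈ C.verts ∨ v ∈ W
  verts_subset : C.verts ⊆ V(G)
  left_disjoint : ∀ v ∈ U, v ∉ C.verts
  right_disjoint : ∀ v ∈ W, v ∉ C.verts
  outer_disjoint : ∀ v ∈ U, v ∉ W
  not_isLink : ∀ e x y, G.IsLink e x y → x ∈ U → y ∉ W

lemma WellLinked.symm (h : WellLinked G C c) : WellLinked G C.rev c where
  left_subset := h.right_subset
  right_subset := h.left_subset
  linked T hT hc := (h.linked T hT hc).symm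
  left_reach x hx := by
    obtain ⟨y, hy, hr⟩ := h.right_reach x hx
    exact ⟨y, hy, hr.symm⟩
  right_reach x hx := by
    obtain ⟨y, hy, hr⟩ := h.left_reach x hx
    exact ⟨y, hy, hr.symm⟩

lemma Placed.symm (h : Placed G s t C U W) : Placed G t s C.rev W U where
  toLeft := h.toRight
  toRight := h.toLeft
  cover v hv := by have := h.cover v hv; simp only [Component.rev]; tauto
  verts_subset := h.verts_subset
  left_disjoint := h.right_disjoint
  right_disjoint := h.left_disjoint
  outer_disjoint v hv hv' := h.outer_disjoint v hv' hv
  not_isLink e x y hl hx hy := h.not_isLink e y x hl.symm hy hx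

/-- How a component `C'` of a `c`-chain of `C` sits in `C`. -/
structure Refines (G : Graph α β) (c : ℕ) (C : Component α β) (U W : Set α)
    (C' : Component α β) (U' W' : Set α) : Prop where
  verts_subset : C'.verts ⊆ C.verts
  left_subset : U ⊆ U'
  right_subset : W ⊆ W'
  left : (C'.left = C.left ∧ C'.leftSep = C.leftSep ∧ U' = U) ∨
    (C.left ⊆ U' ∧ C'.leftSep.ncard = c ∧ C'.leftSep ⊆ E(G.induce C.verts))
  right : (C'.right = C.right ∧ C'.rightSep = C.rightSep ∧ W' = W) ∨
    (C.right ⊆ W' ∧ C'.rightSep.ncard = c ∧ C'.rightSep ⊆ E(G.induce C.verts))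

end Invariants

/-! ### Cutting off one component of a chain -/

section ChainStep

variable {α β : Type*} {G : Graph α β} {s t : α} {C : Component α β} {U W : Set α} {c : ℕ}
  {S : Set β} {R : Set α}

/-- The first component of a chain of `C`, cut off by `S`. -/
def Component.head (G : Graph α β) (C : Component α β) (S : Set β) (R : Set α) :
    Component α β where
  verts := R
  left := C.left
  right := {v ∈ R | ∃ e ∈ S, G.Inc e v}
  leftSep := C.leftSep
  rightSep := S

/-- What is left of `C` once the first component of a chain is cut off by `S`. -/
def Component.rest (G : Graph α β) (C : Component α β) (S : Set β) (R : Set α) :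
    Component α β where
  verts := C.verts \ R
  left := {v ∈ C.verts \ R | ∃ e ∈ S, G.Inc e v}
  right := C.right
  leftSep := S
  rightSep := C.rightSep

/-- The properties of the cut `S` of `C` around `R` that survive the choice of `S`. -/
structure IsCutAt (G : Graph α β) (C : Component α β) (S : Set β) (R : Set α) : Prop where
  subset : R ⊆ C.verts
  left_subset : C.left ⊆ R
  right_notMem : ∀ v ∈ C.right, v ∉ R
  crosses : ∀ e ∈ S, ∃ x ∈ R, ∃ y ∈ C.verts \ R, G.IsLink e x y
  mem_of_crosses : ∀ e x y, G.IsLink e x y → x ∈ R → y ∈ C.verts \ R → e ∈ S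
  reach_left : ∀ x ∈ R, ∃ l ∈ C.left, Reachable (G.induce R) l x
  reach_right : ∀ e x y, G.IsLink e x y → x ∈ R → y ∈ C.verts \ R →
    ∃ r ∈ C.right, Reachable (G.induce (C.verts \ R)) y r

lemma IsCutAt.inc_iff_left (h : IsCutAt G C S R) {v : α} :
    v ∈ (Component.head G C S R).right ↔ v ∈ R ∧ ∃ e, ∃ y ∈ C.verts \ R, G.IsLink e v y := by
  constructor
  · rintro ⟨hv, e, he, hinc⟩
    refine ⟨hv, e, ?_⟩
    obtain ⟨x, hx, y, hy, hl⟩ := h.crosses e he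
    obtain rfl | rfl := hinc.eq_or_eq_of_isLink hl
    · exact ⟨y, hy, hl⟩
    · exact absurd hv hy.2
  · rintro ⟨hv, e, y, hy, hl⟩
    exact ⟨hv, e, h.mem_of_crosses e v y hl hv hy, hl.inc_left⟩

lemma IsCutAt.inc_iff_right (h : IsCutAt G C S R) {v : α} :
    v ∈ (Component.rest G C S R).left ↔ v ∈ C.verts \ R ∧ ∃ e, ∃ x ∈ R, G.IsLink e x v := by
  constructor
  · rintro ⟨hv, e, he, hinc⟩
    refine ⟨hv, e, ?_⟩
    obtain ⟨x, hx, y, hy, hl⟩ := h.crosses e he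
    obtain rfl | rfl := hinc.eq_or_eq_of_isLink hl
    · exact absurd hx hv.2
    · exact ⟨x, hx, hl⟩
  · rintro ⟨hv, e, x, hx, hl⟩
    exact ⟨hv, e, h.mem_of_crosses e x v hl hx hv, hl.inc_right⟩

/-- By minimality, restoring any single edge `e` of `S` links the boundary sets. Since `R` can be
left only through `S`, the edge `e` itself must lead out of `R`, and its outer end must reach the
right boundary outside `R`. -/
lemma IsMinimalSeparator.isCutAt (hwl : WellLinked G C c)
    (hS : IsMinimalSeparator (G.induce C.verts) C.left C.right S)
    (hR : R = reachSet ((G.induce C.verts).deleteEdges S) C.left) : IsCutAt G C S R := by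
  have hRC : R ⊆ C.verts := by
    rw [hR]; exact fun v hv ↦ reachSet_subset_vertexSet hv
  have hlR : C.left ⊆ R := by
    rw [hR]; exact subset_reachSet hwl.left_subset
  have hrR : ∀ v ∈ C.right, v ∉ R := by
    rw [hR]; exact not_linked_iff.1 hS.1.2
  have hclosed : ∀ e x y, G.IsLink e x y → x ∈ R → y ∈ C.verts \ R → e ∈ S := by
    intro e x y hl hx hy
    by_contra he
    apply hy.2
    rw [hR] at hx ⊢
    exact reachSet_closed e x y (isLink_induce_deleteEdges.2 ⟨⟨hl, hRC (hR ▸ hx), hy.1⟩, he⟩) hx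
  have hlink : ∀ e ∈ S, Linked ((G.induce C.verts).deleteEdges (S \ {e})) C.left C.right := by
    intro e he
    have := hS.2 (S \ {e}) ⟨Set.sdiff_subset, fun h ↦ (h he).2 rfl⟩
    by_contra hn
    exact this ⟨Set.sdiff_subset.trans hS.1.1, hn⟩
  have hcross : ∀ e ∈ S, ∃ x ∈ R, ∃ y ∈ C.verts \ R, G.IsLink e x y := by
    intro e he
    by_contra! hno
    obtain ⟨y, hy, hyR⟩ := (hlink e he).exists_mem_of_closed hlR (by
      intro f a b hl ha
      rw [isLink_induce_deleteEdges] at hl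
      by_contra hb
      have hf := hclosed f a b hl.1.1 ha ⟨hl.1.2.2, hb⟩
      have : f = e := by
        by_contra hfe
        exact hl.2 ⟨hf, hfe⟩
      subst this
      exact hno a ha b ⟨hl.1.2.2, hb⟩ hl.1.1)
    exact hrR y hy hyR
  refine ⟨hRC, hlR, hrR, hcross, hclosed, ?_, ?_⟩
  · intro x hx
    have hx' := hx
    rw [hR] at hx'
    obtain ⟨l, hl, hr⟩ := hx'
    refine ⟨l, hl, hr.mono_of_closed (B := R) (hlR hl) (hlR hl) fun e a b hab ha ↦ ?_⟩
    rw [isLink_induce_deleteEdges] at hab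
    have hb : b ∈ R := by
      by_contra hb
      exact hab.2 (hclosed e a b hab.1.1 ha ⟨hab.1.2.2, hb⟩)
    exact ⟨hb, isLink_induce.2 ⟨hab.1.1, ha, hb⟩⟩
  · intro e x y hl hx hy
    by_contra! hno
    obtain ⟨r, hr, hrB⟩ := (hlink e (hclosed e x y hl hx hy)).exists_mem_of_closed
      (B := R ∪ reachSet (G.induce (C.verts \ R)) {y}) (hlR.trans Set.subset_union_left) (by
      intro f a b hf ha
      rw [isLink_induce_deleteEdges] at hf
      by_cases hbR : b ∈ R
      · exact Or.inl hbR
      have hb : b ∈ C.verts \ R := ⟨hf.1.2.2, hbR⟩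
      right
      rcases ha with ha | ha
      · have hfS := hclosed f a b hf.1.1 ha hb
        have : f = e := by
          by_contra hfe
          exact hf.2 ⟨hfS, hfe⟩
        subst this
        obtain h | h := hf.1.1.right_eq_or_eq hl
        · exact absurd hx (h ▸ hbR)
        · subst h
          exact ⟨b, rfl, .refl hb⟩
      · have ha' : a ∈ C.verts \ R := reachSet_subset_vertexSet ha
        exact reachSet_closed f a b (isLink_induce.2 ⟨hf.1.1, ha', hb⟩) ha)
    rcases hrB with h | ⟨_, rfl, h⟩
    · exact hrR r hr h
    · exact hno r hr h

/-- A path across `C` ends outside `R`; after its last departure from `R` it starts on the new left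
boundary and stays in the remainder. -/
lemma IsCutAt.wellLinked_rest (h : IsCutAt G C S R) (hwl : WellLinked G C c) :
    WellLinked G (Component.rest G C S R) c where
  left_subset _ hv := hv.1
  right_subset v hv := ⟨hwl.right_subset hv, h.right_notMem v hv⟩
  linked T hT hc := by
    have hlink := hwl.linked T hT hc
    by_contra hno
    rw [not_linked_iff] at hno
    obtain ⟨y, hy, hyB⟩ := hlink.exists_mem_of_closed (B := R ∪ reachSet
      ((G.induce (C.verts \ R)).deleteEdges T) (Component.rest G C S R).left)
      (h.left_subset.trans Set.subset_union_left) (by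
      intro f a b hf ha
      rw [isLink_induce_deleteEdges] at hf
      by_cases hbR : b ∈ R
      · exact Or.inl hbR
      have hb : b ∈ C.verts \ R := ⟨hf.1.2.2, hbR⟩
      right
      rcases ha with ha | ha
      · exact ⟨b, h.inc_iff_right.2 ⟨hb, f, a, ha, hf.1.1⟩, .refl hb⟩
      · have ha' : a ∈ C.verts \ R := reachSet_subset_vertexSet ha
        exact reachSet_closed f a b (isLink_induce_deleteEdges.2 ⟨⟨hf.1.1, ha', hb⟩, hf.2⟩) ha)
    rcases hyB with hyB | hyB
    · exact h.right_notMem y hy hyB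
    · exact hno y hy hyB
  left_reach x hx := by
    obtain ⟨hx, e, y, hy, hl⟩ := h.inc_iff_right.1 hx
    exact h.reach_right e y x hl hy hx
  right_reach y hy := by
    obtain ⟨x, hx, hr⟩ := hwl.right_reach y hy
    have hyB := hr.mem_of_closed (B := R ∪ reachSet
      (G.induce (C.verts \ R)) (Component.rest G C S R).left) (Or.inl (h.left_subset hx)) (by
      intro f a b hf ha
      rw [isLink_induce] at hf
      by_cases hbR : b ∈ R
      · exact Or.inl hbR
      have hb : b ∈ C.verts \ R := ⟨hf.2.2, hbR⟩
      right
      rcases ha with ha | ha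
      · exact ⟨b, h.inc_iff_right.2 ⟨hb, f, a, ha, hf.1⟩, .refl hb⟩
      · have ha' : a ∈ C.verts \ R := reachSet_subset_vertexSet ha
        exact reachSet_closed f a b (isLink_induce.2 ⟨hf.1, ha', hb⟩) ha)
    rcases hyB with hyB | ⟨l, hl, hr⟩
    · exact absurd hyB (h.right_notMem y hy)
    · exact ⟨l, hl, hr⟩

/-- Here importance is used. A cut of at most `c` edges between the boundary sets of the head would
also separate those of `C`, with its reachable set inside `R`. The inclusion is strict: `1 ≤ c`
gives an edge in `S`, and its inner end is not reached. -/
lemma IsImportantSeparator.wellLinked_head (hE : E(G).Finite) (h : IsCutAt G C S R)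
    (hwl : WellLinked G C c) (hc : 1 ≤ c) (hcard : S.ncard = c)
    (hS : IsImportantSeparator (G.induce C.verts) C.left C.right S)
    (hR : R = reachSet ((G.induce C.verts).deleteEdges S) C.left) :
    WellLinked G (Component.head G C S R) (c + 1) where
  left_subset := h.left_subset
  right_subset _ hv := hv.1
  linked T hT hTc := by
    by_contra hno
    rw [not_linked_iff] at hno
    set B := reachSet ((G.induce R).deleteEdges T) C.left with hB
    have hBR : B ⊆ R := fun v hv ↦ reachSet_subset_vertexSet hv
    have hsub : reachSet ((G.induce C.verts).deleteEdges (T ∩ E(G.induce R))) C.left ⊆ B := by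
      refine reachSet_subset (subset_reachSet h.left_subset) fun e a b hl ha ↦ ?_
      rw [isLink_induce_deleteEdges] at hl
      by_cases hb : b ∈ R
      · have hab : (G.induce R).IsLink e a b := isLink_induce.2 ⟨hl.1.1, hBR ha, hb⟩
        exact reachSet_closed e a b (isLink_deleteEdges.2
          ⟨hab, fun heT ↦ hl.2 ⟨heT, hab.edge_mem⟩⟩) ha
      · exact absurd ha (hno a (h.inc_iff_left.2 ⟨hBR ha, e, b, ⟨hl.1.2.2, hb⟩, hl.1.1⟩))
    refine hS.2 (T ∩ E(G.induce R)) ⟨?_, ?_⟩ ?_ ⟨?_, ?_⟩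
    · rintro e ⟨-, he⟩
      obtain ⟨x, y, hl⟩ := Graph.exists_isLink_of_mem_edgeSet he
      rw [isLink_induce] at hl
      exact (isLink_induce.2 ⟨hl.1, h.subset hl.2.1, h.subset hl.2.2⟩).edge_mem
    · exact not_linked_iff.2 fun y hy hyB ↦ h.right_notMem y hy (hBR (hsub hyB))
    · have := Set.ncard_le_ncard (Set.inter_subset_left : T ∩ E(G.induce R) ⊆ T) hT
      omega
    · rw [← hR]; exact hsub.trans hBR
    · rw [← hR]
      intro hle
      have hne : S.Nonempty := by
        rw [← Set.ncard_pos (hE.subset ?_)]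
        · omega
        · intro e he
          obtain ⟨x, _, y, _, hl⟩ := h.crosses e he
          exact hl.edge_mem
      obtain ⟨e, he⟩ := hne
      obtain ⟨x, hx, y, hy, hl⟩ := h.crosses e he
      exact hno x (h.inc_iff_left.2 ⟨hx, e, y, hy, hl⟩) (hsub (hle hx))
  left_reach l hl := by
    obtain ⟨y, hy, hr⟩ := hwl.left_reach l hl
    by_contra! hno
    have hyR : y ∈ reachSet (G.induce R) {l} := by
      refine hr.mem_of_closed ⟨l, rfl, .refl (h.left_subset hl)⟩ fun e a b hab ha ↦ ?_
      rw [isLink_induce] at hab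
      have haR : a ∈ R := reachSet_subset_vertexSet ha
      by_cases hb : b ∈ R
      · exact reachSet_closed e a b (isLink_induce.2 ⟨hab.1, haR, hb⟩) ha
      · obtain ⟨_, rfl, ha⟩ := ha
        exact absurd ha (hno a (h.inc_iff_left.2 ⟨haR, e, b, ⟨hab.2.2, hb⟩, hab.1⟩))
    exact h.right_notMem y hy (reachSet_subset_vertexSet hyR)
  right_reach y hy := h.reach_left y hy.1

/-- What lies beyond `S` joins the right part. The point to check is that `t` still reaches the
outer ends of `S` there: through `W` to the right boundary of `C`, then back by `reach_right`. -/
lemma IsCutAt.placed_head (h : IsCutAt G C S R) (hp : Placed G s t C U W)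
    (hr : C.right ⊆ C.verts) :
    Placed G s t (Component.head G C S R) U (W ∪ C.verts \ R) where
  toLeft := {
    mem_leftSep := by
      intro e
      refine (hp.toLeft.mem_leftSep e).trans ⟨?_, ?_⟩
      · rintro ⟨x, hx, y, hy, hl⟩
        exact ⟨x, hx, y, h.left_subset (hp.toLeft.mem_left e x y hl hx hy), hl⟩
      · rintro ⟨x, hx, y, hy, hl⟩
        exact ⟨x, hx, y, h.subset hy, hl⟩
    mem_left := fun e x y hl hx hy ↦ hp.toLeft.mem_left e x y hl hx (h.subset hy)
    source := hp.toLeft.source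
    attached := hp.toLeft.attached
    reach := fun e x y hl hx hy ↦ hp.toLeft.reach e x y hl hx (h.subset hy) }
  toRight := by
    have hRW : ∀ e x y, G.IsLink e x y → x ∈ W ∪ C.verts \ R → y ∈ R → x ∈ C.verts \ R := by
      rintro e x y hl (hx | hx) hy
      · exact absurd hy (h.right_notMem y (hp.toRight.mem_left e x y hl hx (h.subset hy)))
      · exact hx
    constructor
    · intro e
      constructor
      · intro he
        obtain ⟨x, hx, y, hy, hl⟩ := h.crosses e he
        exact ⟨y, Or.inr hy, x, hx, hl.symm⟩
      · rintro ⟨x, hx, y, hy, hl⟩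
        exact h.mem_of_crosses e y x hl.symm hy (hRW e x y hl hx hy)
    · intro e x y hl hx hy
      exact h.inc_iff_left.2 ⟨hy, e, x, hRW e x y hl hx hy, hl.symm⟩
    · left
      rcases hp.toRight.source with ht | ht
      · exact Or.inl ht
      · have htr : t ∈ C.right := by
          have : C.right = {t} := ht
          rw [this]; rfl
        exact Or.inr ⟨hr htr, h.right_notMem t htr⟩
    · intro x hx
      obtain ⟨hx, e, y, hy, hl⟩ := h.inc_iff_left.1 hx
      exact Or.inr ⟨y, Or.inr hy, e, hl.symm⟩
    · intro e x y hl hx hy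
      obtain ⟨r, hr, hxr⟩ := h.reach_right e y x hl.symm hy (hRW e x y hl hx hy)
      have hxr' : Reachable (G.induce (W ∪ C.verts \ R)) r x :=
        hxr.symm.mono (Or.inr hxr.right_mem) fun f a b hab ↦ by
          rw [isLink_induce] at hab ⊢
          exact ⟨hab.1, Or.inr hab.2.1, Or.inr hab.2.2⟩
      refine Reachable.trans ?_ hxr'
      rcases hp.toRight.attached r hr with rfl | ⟨w, hw, f, hf⟩
      · exact .refl hxr'.1
      · have hw' := hp.toRight.reach f w r hf hw hxr.right_mem.1
        have : Reachable (G.induce (W ∪ C.verts \ R)) t w :=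
          hw'.mono (Or.inl hw'.1) fun f a b hab ↦ by
            rw [isLink_induce] at hab ⊢
            exact ⟨hab.1, Or.inl hab.2.1, Or.inl hab.2.2⟩
        exact this.tail (isLink_induce.2 ⟨hf, Or.inl hw, hxr'.1⟩)
  cover v hv := by
    have := hp.cover v hv
    simp only [Component.head, Set.mem_union, Set.mem_sdiff]
    tauto
  verts_subset := h.subset.trans hp.verts_subset
  left_disjoint v hv hvR := hp.left_disjoint v hv (h.subset hvR)
  right_disjoint := by
    rintro v (hv | hv) hvR
    · exact hp.right_disjoint v hv (h.subset hvR)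
    · exact hv.2 hvR
  outer_disjoint := by
    rintro v hv (hv' | hv')
    · exact hp.outer_disjoint v hv hv'
    · exact hp.left_disjoint v hv hv'.1
  not_isLink := by
    rintro e x y hl hx (hy | hy)
    · exact hp.not_isLink e x y hl hx hy
    · exact hy.2 (h.left_subset (hp.toLeft.mem_left e x y hl hx hy.1))

lemma IsCutAt.placed_rest (h : IsCutAt G C S R) (hp : Placed G s t C U W) :
    Placed G s t (Component.rest G C S R) (U ∪ R) W where
  toLeft := by
    have hUR : ∀ e x y, G.IsLink e x y → x ∈ U ∪ R → y ∈ C.verts \ R → x ∈ R := by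
      rintro e x y hl (hx | hx) hy
      · exact absurd (h.left_subset (hp.toLeft.mem_left e x y hl hx hy.1)) hy.2
      · exact hx
    constructor
    · intro e
      constructor
      · intro he
        obtain ⟨x, hx, y, hy, hl⟩ := h.crosses e he
        exact ⟨x, Or.inr hx, y, hy, hl⟩
      · rintro ⟨x, hx, y, hy, hl⟩
        exact h.mem_of_crosses e x y hl (hUR e x y hl hx hy) hy
    · intro e x y hl hx hy
      exact h.inc_iff_right.2 ⟨hy, e, x, hUR e x y hl hx hy, hl⟩
    · left
      rcases hp.toLeft.source with hs | hs
      · exact Or.inl hs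
      · exact Or.inr (h.left_subset (hs ▸ rfl))
    · intro x hx
      obtain ⟨hx, e, y, hy, hl⟩ := h.inc_iff_right.1 hx
      exact Or.inr ⟨y, Or.inr hy, e, hl⟩
    · intro e x y hl hx hy
      obtain ⟨l, hlC, hlx⟩ := h.reach_left x (hUR e x y hl hx hy)
      have hlx' : Reachable (G.induce (U ∪ R)) l x :=
        hlx.mono (Or.inr hlx.1) fun f a b hab ↦ by
          rw [isLink_induce] at hab ⊢
          exact ⟨hab.1, Or.inr hab.2.1, Or.inr hab.2.2⟩
      refine Reachable.trans ?_ hlx'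
      rcases hp.toLeft.attached l hlC with rfl | ⟨u, hu, f, hf⟩
      · exact .refl hlx'.1
      · have hu' := hp.toLeft.reach f u l hf hu (h.subset hlx.1)
        have : Reachable (G.induce (U ∪ R)) s u :=
          hu'.mono (Or.inl hu'.1) fun f a b hab ↦ by
            rw [isLink_induce] at hab ⊢
            exact ⟨hab.1, Or.inl hab.2.1, Or.inl hab.2.2⟩
        exact this.tail (isLink_induce.2 ⟨hf, Or.inl hu, hlx'.1⟩)
  toRight := {
    mem_leftSep := by
      intro e
      refine (hp.toRight.mem_leftSep e).trans ⟨?_, ?_⟩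
      · rintro ⟨x, hx, y, hy, hl⟩
        exact ⟨x, hx, y, ⟨hy, h.right_notMem y (hp.toRight.mem_left e x y hl hx hy)⟩, hl⟩
      · rintro ⟨x, hx, y, hy, hl⟩
        exact ⟨x, hx, y, hy.1, hl⟩
    mem_left := fun e x y hl hx hy ↦ hp.toRight.mem_left e x y hl hx hy.1
    source := hp.toRight.source
    attached := hp.toRight.attached
    reach := fun e x y hl hx hy ↦ hp.toRight.reach e x y hl hx hy.1 }
  cover v hv := by
    have := hp.cover v hv
    simp only [Component.rest, Set.mem_union, Set.mem_sdiff]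
    tauto
  verts_subset := Set.sdiff_subset.trans hp.verts_subset
  left_disjoint := by
    rintro v (hv | hv) hvR
    · exact hp.left_disjoint v hv hvR.1
    · exact hvR.2 hv
  right_disjoint v hv hvR := hp.right_disjoint v hv hvR.1
  outer_disjoint := by
    rintro v (hv | hv) hv'
    · exact hp.outer_disjoint v hv hv'
    · exact hp.right_disjoint v hv' (h.subset hv)
  not_isLink := by
    rintro e x y hl (hx | hx) hy
    · exact hp.not_isLink e x y hl hx hy
    · exact h.right_notMem x (hp.toRight.mem_left e y x hl.symm hy (h.subset hx)) hx

/-- Take a separator of size `c` with the fewest reachable vertices. As none has fewer than `c`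
edges, it is minimal, and any competitor against its importance has exactly `c` edges too. -/
lemma exists_isImportantSeparator {P X Y : Set α} (hP : P.Finite) (hE : E(G).Finite)
    (hlink : ∀ T : Set β, T.Finite → T.ncard < c → Linked ((G.induce P).deleteEdges T) X Y)
    {T : Set β} (hT : IsSeparator (G.induce P) X Y T) (hTc : T.ncard = c) :
    ∃ S, IsImportantSeparator (G.induce P) X Y S ∧ S.ncard = c := by
  have hfin : E(G.induce P).Finite := hE.subset fun e he ↦ by
    obtain ⟨x, y, hl⟩ := Graph.exists_isLink_of_mem_edgeSet he
    exact (isLink_induce.1 hl).1.edge_mem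
  let f : Set β → ℕ := fun T ↦ (reachSet ((G.induce P).deleteEdges T) X).ncard
  obtain ⟨S, ⟨hS, hSc⟩, hmin⟩ := exists_minimalFor_of_wellFoundedLT
    (fun T ↦ IsSeparator (G.induce P) X Y T ∧ T.ncard = c) f ⟨T, hT, hTc⟩
  refine ⟨S, ⟨⟨hS, fun S' hS' hsep ↦ ?_⟩, fun S' hsep hle hss ↦ ?_⟩, hSc⟩
  · have hlt := Set.ncard_lt_ncard hS' (hfin.subset hS.1)
    exact hsep.2 (hlink S' (hfin.subset hsep.1) (hSc ▸ hlt))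
  · have hge : c ≤ S'.ncard := by
      by_contra hlt
      exact hsep.2 (hlink S' (hfin.subset hsep.1) (not_le.1 hlt))
    have hlt : f S' < f S := Set.ncard_lt_ncard hss (hP.subset fun v hv ↦ reachSet_subset_vertexSet hv)
    exact absurd (hmin ⟨hsep, by omega⟩ hlt.le) (not_le.2 hlt)

lemma WellLinked.succ (hV : V(G).Finite) (hE : E(G).Finite) (hC : C.verts ⊆ V(G))
    (hwl : WellLinked G C c)
    (hno : ¬ ∃ S : Set β, IsImportantSeparator (G.induce C.verts) C.left C.right S ∧ S.ncard = c) :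
    WellLinked G C (c + 1) where
  left_subset := hwl.left_subset
  right_subset := hwl.right_subset
  linked T hT hTc := by
    by_contra hnl
    have hsep : IsSeparator (G.induce C.verts) C.left C.right (T ∩ E(G.induce C.verts)) := by
      refine ⟨Set.inter_subset_right, fun ⟨x, hx, y, hy, hr⟩ ↦ hnl ⟨x, hx, y, hy, ?_⟩⟩
      refine hr.mono hr.1 fun e a b hl ↦ ?_
      rw [isLink_deleteEdges] at hl ⊢
      exact ⟨hl.1, fun he ↦ hl.2 ⟨he, hl.1.edge_mem⟩⟩
    have hle := Set.ncard_le_ncard (Set.inter_subset_left : T ∩ E(G.induce C.verts) ⊆ T) hT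
    have hge : ¬ (T ∩ E(G.induce C.verts)).ncard < c := fun hlt ↦
      hsep.2 (hwl.linked _ (hT.subset Set.inter_subset_left) hlt)
    exact hno (exists_isImportantSeparator (hV.subset hC) hE hwl.linked hsep (by omega))
  left_reach := hwl.left_reach
  right_reach := hwl.right_reach

end ChainStep

-- The remainder keeps the bound `c`, which is what the next cut needs; each head gains `c + 1` by
-- importance, and the last component gains it because no important separator of size `c` is left.
theorem IsChain.refines {α β : Type*} {G : Graph α β} {s t : α} {c : ℕ} {C : Component α β}
    {L : List (Component α β)} (hV : V(G).Finite) (hE : E(G).Finite) (hc : 1 ≤ c)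
    (h : IsChain G c C L) {U W : Set α} (hp : Placed G s t C U W) (hwl : WellLinked G C c) :
    (∀ v ∈ C.verts, ∃ C' ∈ L, v ∈ C'.verts) ∧ ∀ C' ∈ L, ∃ U' W',
      Placed G s t C' U' W' ∧ WellLinked G C' (c + 1) ∧ Refines G c C U W C' U' W' := by
  induction h generalizing U W with
  | last C hno =>
    refine ⟨fun v hv ↦ ⟨C, by simp, hv⟩, fun C' hC' ↦ ?_⟩
    obtain rfl : C' = C := by simpa using hC'
    exact ⟨U, W, hp, hwl.succ hV hE hp.verts_subset hno, ⟨subset_rfl, subset_rfl, subset_rfl,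
      Or.inl ⟨rfl, rfl, rfl⟩, Or.inl ⟨rfl, rfl, rfl⟩⟩⟩
  | step C S R L hS hcard hR hL ih =>
    have hcut : IsCutAt G C S R := hS.1.isCutAt hwl hR
    obtain ⟨hcov, hrest⟩ := ih (hcut.placed_rest hp) (hcut.wellLinked_rest hwl)
    have hSE : S ⊆ E(G.induce C.verts) := hS.1.1.1
    refine ⟨fun v hv ↦ ?_, fun C' hC' ↦ ?_⟩
    · by_cases hvR : v ∈ R
      · exact ⟨_, List.mem_cons_self, hvR⟩
      · obtain ⟨C', hC', hv'⟩ := hcov v ⟨hv, hvR⟩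
        exact ⟨C', List.mem_cons_of_mem _ hC', hv'⟩
    · rcases List.mem_cons.1 hC' with rfl | hC'
      · refine ⟨U, _, hcut.placed_head hp hwl.right_subset, hS.wellLinked_head hE hcut hwl hc hcard hR,
          ⟨hcut.subset, subset_rfl, Set.subset_union_left, Or.inl ⟨rfl, rfl, rfl⟩,
            Or.inr ⟨fun v hv ↦ Or.inr ⟨hwl.right_subset hv, hcut.right_notMem v hv⟩, hcard, hSE⟩⟩⟩
      · obtain ⟨U', W', hp', hwl', href⟩ := hrest C' hC'
        have hsub : E(G.induce (C.verts \ R)) ⊆ E(G.induce C.verts) := fun e he ↦ by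
          obtain ⟨x, y, hl⟩ := Graph.exists_isLink_of_mem_edgeSet he
          rw [isLink_induce] at hl
          exact (isLink_induce.2 ⟨hl.1, hl.2.1.1, hl.2.2.1⟩).edge_mem
        have hU : U ∪ R ⊆ U' := href.left_subset
        refine ⟨U', W', hp', hwl', ⟨href.verts_subset.trans Set.sdiff_subset,
          Set.subset_union_left.trans hU, href.right_subset, Or.inr ?_, ?_⟩⟩
        · refine ⟨(hcut.left_subset.trans Set.subset_union_right).trans hU, ?_⟩
          rcases href.left with ⟨-, h, -⟩ | ⟨-, h, h'⟩
          · rw [h]; exact ⟨hcard, hSE⟩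
          · exact ⟨h, h'.trans hsub⟩
        · rcases href.right with h | ⟨h, h', h''⟩
          · exact Or.inl h
          · exact Or.inr ⟨h, h', h''.trans hsub⟩

/-! ### A chain component as a slab crossed by a small cut of `H` -/

section Slab

variable {α β : Type*} {G H : Graph α β} {k : ℕ} {A U R W Vl Vr Z N : Set α}
  {nl nr : Set α → ℕ} {u w : α}

/-- The edges of `H` leaving `A`. -/
def cut (H : Graph α β) (A : Set α) : Set β := {e | ∃ x y, H.IsLink e x y ∧ x ∈ A ∧ y ∉ A}

/-- The edges of `H` between `U` and `Z`. -/
def between (H : Graph α β) (U Z : Set α) : Set β := {e | ∃ x ∈ U, ∃ y ∈ Z, H.IsLink e x y}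

lemma cut_compl : cut H Aᶜ = cut H A := by
  ext e
  constructor
  · rintro ⟨x, y, hl, hx, hy⟩
    exact ⟨y, x, hl.symm, not_not.1 hy, hx⟩
  · rintro ⟨x, y, hl, hx, hy⟩
    exact ⟨y, x, hl.symm, hy, not_not.2 hx⟩

lemma cut_subset : cut H A ⊆ E(H) := by
  rintro e ⟨x, y, hl, -⟩
  exact hl.edge_mem

lemma between_subset : between H U Z ⊆ E(H) := by
  rintro e ⟨x, -, y, -, hl⟩
  exact hl.edge_mem

lemma ncard_between_add (hfin : E(H).Finite) (hd : ∀ v ∈ U, v ∉ R) (hZ : Z ⊆ R) :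
    (between H U Z).ncard + (between H U (R \ Z)).ncard = (between H U R).ncard := by
  rw [← Set.ncard_union_eq _ (hfin.subset between_subset) (hfin.subset between_subset)]
  · congr 1
    ext e
    constructor
    · rintro (⟨x, hx, y, hy, hl⟩ | ⟨x, hx, y, hy, hl⟩)
      · exact ⟨x, hx, y, hZ hy, hl⟩
      · exact ⟨x, hx, y, hy.1, hl⟩
    · rintro ⟨x, hx, y, hy, hl⟩
      by_cases hyZ : y ∈ Z
      · exact Or.inl ⟨x, hx, y, hyZ, hl⟩
      · exact Or.inr ⟨x, hx, y, ⟨hy, hyZ⟩, hl⟩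
  · rw [Set.disjoint_left]
    rintro e ⟨x, hx, y, hy, hl⟩ ⟨x', hx', y', hy', hl'⟩
    obtain ⟨-, rfl⟩ | ⟨rfl, rfl⟩ := hl.eq_and_eq_or_eq_and_eq hl'
    · exact hy'.2 hy
    · exact hd _ hx' (hZ hy)

/-- Either `A` contains all of `Vl`, or the deficit `nl` counts the edges from `U` that miss a set
and no cut that agrees with `A` outside the slab is smaller than the one between `U` and `R`. -/
def DeficitBound (H : Graph α β) (A U R W Vl Vr : Set α) (nl : Set α → ℕ) : Prop :=
  Vl ⊆ A ∨ ((∀ Z ⊆ R, nl (Z ∩ Vl) = (between H U (R \ Z)).ncard) ∧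
    ∀ Z, A ∩ U ⊆ Z → Z ∩ W ⊆ A → Z ∩ Vr ⊆ A → (between H U R).ncard ≤ (cut H Z).ncard)

/-- The vertices split into parts `U`, `R`, `W` without edges between `U` and `W`, and `H[R]` meets
the demands between `Vl` and `Vr` in `G[R]` with values `k - nl X - nr Y`. The set `A` defines a cut
of `H` with fewer than `k` edges. -/
structure Slab (G H : Graph α β) (k : ℕ) (A U R W Vl Vr : Set α) (nl nr : Set α → ℕ) : Prop where
  isLink : ∀ e x y, H.IsLink e x y → G.IsLink e x y
  finite : E(H).Finite
  cover : ∀ e x y, H.IsLink e x y → x ∈ U ∨ x ∈ R ∨ x ∈ W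
  left_disjoint : ∀ v ∈ U, v ∉ R
  right_disjoint : ∀ v ∈ W, v ∉ R
  outer_disjoint : ∀ v ∈ U, v ∉ W
  not_isLink : ∀ e x y, H.IsLink e x y → x ∈ U → y ∉ W
  left_subset : Vl ⊆ R
  right_subset : Vr ⊆ R
  mem_left : ∀ e x y, H.IsLink e x y → x ∈ U → y ∈ R → y ∈ Vl
  mem_right : ∀ e x y, H.IsLink e x y → x ∈ W → y ∈ R → y ∈ Vr
  left_anti : ∀ X X', X ⊆ X' → nl X' ≤ nl X
  right_anti : ∀ Y Y', Y ⊆ Y' → nr Y' ≤ nr Y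
  left_full : nl Vl = 0
  right_full : nr Vr = 0
  left_bound : DeficitBound H A U R W Vl Vr nl
  right_bound : DeficitBound H Aᶜ W R U Vr Vl nr
  left_reach : ∀ x ∈ Vl, ∃ y ∈ Vr, Reachable (G.induce R) x y
  right_reach : ∀ y ∈ Vr, ∃ x ∈ Vl, Reachable (G.induce R) y x
  demand : ∀ X ⊆ Vl, ∀ Y ⊆ Vr, ∀ F ⊆ E(H.induce R), F.ncard + nl X + nr Y < k →
    Linked ((G.induce R).deleteEdges F) X Y → Linked ((H.induce R).deleteEdges F) X Y
  ncard_cut_lt : (cut H A).ncard < k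

lemma Slab.symm (h : Slab G H k A U R W Vl Vr nl nr) : Slab G H k Aᶜ W R U Vr Vl nr nl where
  isLink := h.isLink
  finite := h.finite
  cover e x y hl := by have := h.cover e x y hl; tauto
  left_disjoint := h.right_disjoint
  right_disjoint := h.left_disjoint
  outer_disjoint v hv hv' := h.outer_disjoint v hv' hv
  not_isLink e x y hl hx hy := h.not_isLink e y x hl.symm hy hx
  left_subset := h.right_subset
  right_subset := h.left_subset
  mem_left := h.mem_right
  mem_right := h.mem_left
  left_anti := h.right_anti
  right_anti := h.left_anti
  left_full := h.right_full
  right_full := h.left_full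
  left_bound := h.right_bound
  right_bound := by rw [compl_compl]; exact h.left_bound
  left_reach := h.right_reach
  right_reach := h.left_reach
  demand X hX Y hY F hF hlt hl := (h.demand Y hY X hX F hF (by omega) hl.symm).symm
  ncard_cut_lt := by rw [cut_compl]; exact h.ncard_cut_lt

/-- The edges of the cut of `A` with an end in `U`. -/
def cutAt (H : Graph α β) (A U : Set α) : Set β := {e ∈ cut H A | ∃ x ∈ U, H.Inc e x}

lemma cutAt_compl : cutAt H Aᶜ U = cutAt H A U := by simp [cutAt, cut_compl]

lemma cut_induce_subset : cut (H.induce R) A ⊆ cut H A := by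
  rintro e ⟨x, y, hl, hx, hy⟩
  exact ⟨x, y, (isLink_induce.1 hl).1, hx, hy⟩

namespace Slab

/-- The three edge sets are disjoint parts of the cut of `A`: no edge joins `U` to `W`, and edges
inside `R` touch neither. -/
lemma ncard_add_lt (h : Slab G H k A U R W Vl Vr nl nr) :
    (cutAt H A U).ncard + (cut (H.induce R) A).ncard + (cutAt H A W).ncard < k := by
  have hfin : (cut H A).Finite := h.finite.subset cut_subset
  have hU : cutAt H A U ⊆ cut H A := fun e he ↦ he.1
  have hW : cutAt H A W ⊆ cut H A := fun e he ↦ he.1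
  have hR : cut (H.induce R) A ⊆ cut H A := cut_induce_subset
  rw [← Set.ncard_union_eq _ (hfin.subset hU) (hfin.subset hR),
    ← Set.ncard_union_eq _ (hfin.subset (Set.union_subset hU hR)) (hfin.subset hW)]
  · exact (Set.ncard_le_ncard (Set.union_subset (Set.union_subset hU hR) hW) hfin).trans_lt
      h.ncard_cut_lt
  · rw [Set.disjoint_left]
    rintro e (⟨-, x, hx, hxe⟩ | ⟨a, b, hl, -⟩) ⟨-, y, hy, hye⟩
    · obtain ⟨z, hl⟩ := hye
      obtain rfl | rfl := hxe.eq_or_eq_of_isLink hl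
      · exact h.outer_disjoint _ hx hy
      · exact h.not_isLink e _ y hl.symm hx hy
    · rw [isLink_induce] at hl
      obtain rfl | rfl := hye.eq_or_eq_of_isLink hl.1
      · exact h.right_disjoint _ hy hl.2.1
      · exact h.right_disjoint _ hy hl.2.2
  · rw [Set.disjoint_left]
    rintro e ⟨-, y, hy, hye⟩ ⟨a, b, hl, -⟩
    rw [isLink_induce] at hl
    obtain rfl | rfl := hye.eq_or_eq_of_isLink hl.1
    · exact h.left_disjoint _ hy hl.2.1
    · exact h.left_disjoint _ hy hl.2.2

/-- The cut of `A ∩ U` has at least as many edges as there are between `U` and `R`. Each of its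
edges either crosses `A` or ends in `R ∩ A`; subtract the latter kind. -/
lemma ncard_between_le (h : Slab G H k A U R W Vl Vr nl nr)
    (hb : ∀ Z, A ∩ U ⊆ Z → Z ∩ W ⊆ A → Z ∩ Vr ⊆ A →
      (between H U R).ncard ≤ (cut H Z).ncard) :
    (between H U (R \ A)).ncard ≤ (cutAt H A U).ncard := by
  have hle := hb (A ∩ U) subset_rfl (fun v hv ↦ hv.1.1) (fun v hv ↦ hv.1.1)
  have hadd := ncard_between_add (Z := R ∩ A) h.finite h.left_disjoint Set.inter_subset_left
  rw [Set.sdiff_self_inter] at hadd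
  have hsub : cut H (A ∩ U) ⊆ cutAt H A U ∪ between H U (R ∩ A) := by
    rintro e ⟨x, y, hl, hx, hy⟩
    by_cases hyA : y ∈ A
    · right
      rcases h.cover e y x hl.symm with hy' | hy' | hy'
      · exact absurd ⟨hyA, hy'⟩ hy
      · exact ⟨x, hx.2, y, ⟨hy', hyA⟩, hl⟩
      · exact absurd hy' (h.not_isLink e x y hl hx.2)
    · exact Or.inl ⟨⟨x, y, hl, hx.1, hyA⟩, x, hx.2, hl.inc_left⟩
  have hfin : (cutAt H A U ∪ between H U (R ∩ A)).Finite :=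
    h.finite.subset (Set.union_subset (fun e he ↦ cut_subset he.1) between_subset)
  have := (Set.ncard_le_ncard hsub hfin).trans (Set.ncard_union_le _ _)
  omega

lemma left_le (h : Slab G H k A U R W Vl Vr nl nr) :
    nl (A ∩ Vl) ≤ (cutAt H A U).ncard := by
  rcases h.left_bound with hb | ⟨heq, hb⟩
  · rw [Set.inter_eq_self_of_subset_right hb, h.left_full]
    exact Nat.zero_le _
  · have := heq (R ∩ A) Set.inter_subset_left
    rw [Set.sdiff_self_inter, Set.inter_right_comm,
      Set.inter_eq_self_of_subset_right h.left_subset, Set.inter_comm] at this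
    rw [this]
    exact h.ncard_between_le hb

lemma deficit_lt (h : Slab G H k A U R W Vl Vr nl nr) :
    (cut (H.induce R) A).ncard + nl (A ∩ Vl) + nr (Aᶜ ∩ Vr) < k := by
  have h1 := h.left_le
  have h2 := h.symm.left_le
  rw [cutAt_compl] at h2
  have h3 := h.ncard_add_lt
  omega

/-- An exchange argument: passing from `A` to `Z` saves the edges of `F` and those of the cut at `U`
(at least as many as lead from `U` to `R \ A`), and costs at most the edges from `U` to `N`. The new
cut still has at least `(between H U R).ncard` edges. -/
lemma ncard_add_lt_of_cut_subset (h : Slab G H k A U R W Vl Vr nl nr)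
    (hb : ∀ Z, A ∩ U ⊆ Z → Z ∩ W ⊆ A → Z ∩ Vr ⊆ A →
      (between H U R).ncard ≤ (cut H Z).ncard)
    (hZU : A ∩ U ⊆ Z) (hZW : Z ∩ W ⊆ A) (hZr : Z ∩ Vr ⊆ A) {F : Set β}
    (hF : F ⊆ cut (H.induce R) A)
    (hcut : cut H Z ⊆ (cut (H.induce R) A \ F) ∪ cutAt H A W ∪ between H U N) :
    F.ncard + (between H U R).ncard + (between H U (R \ A)).ncard <
      k + (between H U N).ncard := by
  have h1 := hb Z hZU hZW hZr
  have h2 := h.ncard_between_le hb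
  have h3 := h.ncard_add_lt
  have hfin : (cut (H.induce R) A).Finite :=
    h.finite.subset (cut_induce_subset.trans cut_subset)
  have h4 := Set.ncard_sdiff_add_ncard_of_subset hF hfin
  have h5 : ((cut (H.induce R) A \ F) ∪ cutAt H A W ∪ between H U N).Finite :=
    h.finite.subset (Set.union_subset (Set.union_subset
      (Set.sdiff_subset.trans (cut_induce_subset.trans cut_subset)) (fun e he ↦ cut_subset he.1))
      between_subset)
  have h6 := (Set.ncard_le_ncard hcut h5).trans (Set.ncard_union_le _ _)
  have h7 := Set.ncard_union_le (cut (H.induce R) A \ F) (cutAt H A W)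
  omega

lemma mem_iff_of_isLink {e : β} {x y : α}
    (hl : ((H.induce R).deleteEdges (cut (H.induce R) A)).IsLink e x y) : x ∈ A ↔ y ∈ A := by
  rw [isLink_deleteEdges] at hl
  constructor
  · intro hx
    by_contra hy
    exact hl.2 ⟨x, y, hl.1, hx, hy⟩
  · intro hy
    by_contra hx
    exact hl.2 ⟨y, x, hl.1.symm, hy, hx⟩

lemma mem_iff_of_reachable {x y : α}
    (hr : Reachable ((H.induce R).deleteEdges (cut (H.induce R) A)) x y) : x ∈ A ↔ y ∈ A :=
  hr.mem_of_closed (B := {v | x ∈ A ↔ v ∈ A}) Iff.rfl fun _ _ _ hl ha ↦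
    ha.trans (mem_iff_of_isLink hl)

/-- Enlarging `X` and `Y` only lowers the deficits, so by `deficit_lt` the cut of `A` inside `R` is
small enough to be deleted in the demand `(X, Y)`. -/
lemma not_reachable_of_same_side (h : Slab G H k A U R W Vl Vr nl nr)
    {X Y : Set α} (hX : X ⊆ Vl) (hY : Y ⊆ Vr) (hXA : A ∩ Vl ⊆ X) (hYA : Aᶜ ∩ Vr ⊆ Y)
    (hXY : ∀ x ∈ X, ∀ y ∈ Y,
      ¬ Reachable ((H.induce R).deleteEdges (cut (H.induce R) A)) x y) :
    ∀ x ∈ X, ∀ y ∈ Y, ¬ Reachable ((G.induce R).deleteEdges (cut (H.induce R) A)) x y := by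
  intro x hx y hy hr
  have h1 := h.deficit_lt
  have h2 := h.left_anti _ _ hXA
  have h3 := h.right_anti _ _ hYA
  obtain ⟨x, hx, y, hy, hr⟩ :=
    h.demand X hX Y hY (cut (H.induce R) A) cut_subset (by omega) ⟨x, hx, y, hy, hr⟩
  exact hXY x hx y hy hr

/-- Both connections hang on the left boundary, so no demand between left and right applies
directly. Demands to the whole of `Vr` are used twice. The first, from the `H`-component `K` of `w`,
shows that the larger `G`-component `K'` of `w` avoids `Vr`. The second, from `J = K' ∩ A`, is
violated if `u` and `w` are joined: `G` would then lead from `x` through `w` out to `Vr`, while `H`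
cannot leave `J`. -/
lemma not_reachable_of_left_left (h : Slab G H k A U R W Vl Vr nl nr) {x q : α}
    (hx : x ∈ Vl) (hxA : x ∈ A)
    (hxu : Reachable ((H.induce R).deleteEdges (cut (H.induce R) A)) x u)
    (hq : q ∈ Vl) (hqA : q ∉ A)
    (hwq : Reachable ((H.induce R).deleteEdges (cut (H.induce R) A)) w q)
    (hno : ∀ y ∈ Vr, ¬ Reachable ((H.induce R).deleteEdges (cut (H.induce R) A)) w y) :
    ¬ Reachable ((G.induce R).deleteEdges (cut (H.induce R) A)) u w := by
  intro huw
  have hHG : ∀ e a b, (H.induce R).IsLink e a b → (G.induce R).IsLink e a b := fun e a b hl ↦ by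
    rw [isLink_induce] at hl ⊢
    exact ⟨h.isLink e a b hl.1, hl.2⟩
  obtain hb | ⟨heq, hb⟩ := h.left_bound
  · exact hqA (hb hq)
  set FR := cut (H.induce R) A with hFR
  have hwA : w ∉ A := fun hw ↦ hqA ((mem_iff_of_reachable hwq).1 hw)
  set K : Set α := {v | Reachable ((H.induce R).deleteEdges FR) w v} with hK
  have hKA : ∀ v ∈ K, v ∉ A := fun v hv hvA ↦ hwA ((mem_iff_of_reachable hv).2 hvA)
  have hKR : K ⊆ R := fun v hv ↦ hv.right_mem
  have hKr : ∀ v ∈ K, v ∉ Vr := fun v hv hvr ↦ hno v hvr hv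
  have hwR : w ∈ R := hwq.1
  set F₂ := cut (H.induce R) K with hF₂
  have hKF : ∀ e a b, (H.induce R).IsLink e a b → a ∈ K → b ∉ K → e ∈ FR := by
    intro e a b hl ha hb'
    by_contra he
    exact hb' (Reachable.tail ha (isLink_deleteEdges.2 ⟨hl, he⟩))
  have hF₂R : F₂ ⊆ FR := by
    rintro e ⟨a, b, hl, ha, hb'⟩
    exact hKF e a b hl ha hb'
  -- Moving `U` and `K` to the side of `A` removes `F₂` from the cut, and among the edges leaving
  -- `U` only those to `(R \ A) \ K` are cut.
  have hlt₂ : F₂.ncard + nl (K ∩ Vl) + nr Vr < k := by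
    have h1 := h.ncard_add_lt_of_cut_subset (Z := A ∪ U ∪ K) (N := (R \ A) \ K) hb
      (fun v hv ↦ Or.inl (Or.inr hv.2))
      (by
        rintro v ⟨(hv | hv) | hv, hvW⟩
        · exact hv
        · exact absurd hvW (h.outer_disjoint v hv)
        · exact absurd (hKR hv) (h.right_disjoint v hvW))
      (by
        rintro v ⟨(hv | hv) | hv, hvr⟩
        · exact hv
        · exact absurd (h.right_subset hvr) (h.left_disjoint v hv)
        · exact absurd hvr (hKr v hv))
      hF₂R (by
        rintro e ⟨a, b, hl, ha, hb'⟩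
        simp only [Set.mem_union, not_or] at hb'
        obtain ⟨⟨hbA, hbU⟩, hbK⟩ := hb'
        rcases h.cover e b a hl.symm with hbU' | hbR | hbW
        · exact absurd hbU' hbU
        · rcases h.cover e a b hl with haU | haR | haW
          · exact Or.inr ⟨a, haU, b, ⟨⟨hbR, hbA⟩, hbK⟩, hl⟩
          · have hlR : (H.induce R).IsLink e a b := isLink_induce.2 ⟨hl, haR, hbR⟩
            rcases ha with (haA | haU) | haK
            · refine Or.inl (Or.inl ⟨⟨a, b, hlR, haA, hbA⟩, ?_⟩)
              rintro ⟨a', b', hl', ha', -⟩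
              obtain ⟨rfl, rfl⟩ | ⟨rfl, rfl⟩ := hl'.eq_and_eq_or_eq_and_eq hlR
              · exact hKA _ ha' haA
              · exact hbK ha'
            · exact absurd haR (h.left_disjoint a haU)
            · obtain ⟨a', b', hl', ha', hb'⟩ := hKF e a b hlR haK hbK
              obtain ⟨rfl, rfl⟩ | ⟨rfl, rfl⟩ := hl'.eq_and_eq_or_eq_and_eq hlR
              · exact absurd ha' (hKA _ haK)
              · exact absurd ha' hbA
          · rcases ha with (haA | haU) | haK
            · exact Or.inl (Or.inr ⟨⟨a, b, hl, haA, hbA⟩, a, haW, hl.inc_left⟩)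
            · exact absurd haW (h.outer_disjoint a haU)
            · exact absurd (hKR haK) (h.right_disjoint a haW)
        · rcases ha with (haA | haU) | haK
          · exact Or.inl (Or.inr ⟨⟨a, b, hl, haA, hbA⟩, b, hbW, hl.inc_right⟩)
          · exact absurd hbW (h.not_isLink e a b hl haU)
          · exact absurd (h.mem_right e b a hl.symm hbW (hKR haK)) (hKr a haK))
    have h2 := heq K hKR
    have h3 := ncard_between_add h.finite h.left_disjoint hKR
    have h4 := ncard_between_add (U := U) (R := R \ A) (Z := K) h.finite
      (fun v hv hv' ↦ h.left_disjoint v hv hv'.1) (fun v hv ↦ ⟨hKR hv, hKA v hv⟩)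
    have h5 := h.right_full
    omega
  have hnl₂ : ¬ Linked ((G.induce R).deleteEdges F₂) (K ∩ Vl) Vr := by
    intro hl
    obtain ⟨y, hy, hyK⟩ := (h.demand _ Set.inter_subset_right _ subset_rfl F₂ cut_subset hlt₂
      hl).exists_mem_of_closed Set.inter_subset_left fun e a b hl ha ↦ by
        rw [isLink_deleteEdges] at hl
        by_contra hb'
        exact hl.2 ⟨a, b, hl.1, ha, hb'⟩
    exact hKr y hyK hy
  set K' : Set α := {v | Reachable ((G.induce R).deleteEdges F₂) w v} with hK'
  have hKK' : K ⊆ K' := fun v hv ↦ hv.mono hwR fun e a b hl ↦ by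
    rw [isLink_deleteEdges] at hl ⊢
    exact ⟨hHG e a b hl.1, fun he ↦ hl.2 (hF₂R he)⟩
  have hK'r : ∀ v ∈ K', v ∉ Vr := fun v hv hvr ↦
    hnl₂ ⟨q, ⟨hwq, hq⟩, v, hvr, (hKK' hwq).symm.trans hv⟩
  have hK'R : K' ⊆ R := fun v hv ↦ hv.right_mem
  set J := K' ∩ A with hJ
  set F₅ := cut (H.induce R) J with hF₅
  -- An edge leaving `K'` must be one of the deleted edges `F₂`, and these have an end in `K ⊆ K'`.
  have hexit : ∀ e a b, (G.induce R).IsLink e a b → a ∈ K' → b ∉ K' → a ∈ K := by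
    intro e a b hl ha hb'
    by_contra haK
    refine hb' (Reachable.tail ha (isLink_deleteEdges.2 ⟨hl, ?_⟩))
    rintro ⟨a', b', hl', ha', -⟩
    obtain ⟨rfl, rfl⟩ | ⟨rfl, rfl⟩ := (hHG _ _ _ hl').eq_and_eq_or_eq_and_eq hl
    · exact haK ha'
    · exact hb' (hKK' ha')
  have hJout : ∀ e a b, (H.induce R).IsLink e a b → a ∈ J → b ∉ J → b ∈ K' ∧ b ∉ A := by
    intro e a b hl ha hb'
    have hbK' : b ∈ K' := by
      by_contra hbK'
      exact hKA a (hexit e a b (hHG e a b hl) ha.1 hbK') ha.2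
    exact ⟨hbK', fun hbA ↦ hb' ⟨hbK', hbA⟩⟩
  have hF₅R : F₅ ⊆ FR := by
    rintro e ⟨a, b, hl, ha, hb'⟩
    exact ⟨a, b, hl, ha.2, (hJout e a b hl ha hb').2⟩
  have hF₅K : ∀ e a b, (G.induce R).IsLink e a b → a ∉ K' → e ∉ F₅ := by
    rintro e a b hl ha ⟨a', b', hl', ha', hb'⟩
    have := hJout e a' b' hl' ha' hb'
    obtain ⟨rfl, rfl⟩ | ⟨rfl, rfl⟩ := (hHG _ _ _ hl').eq_and_eq_or_eq_and_eq hl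
    · exact ha ha'.1
    · exact ha this.1
  have hJR : J ⊆ R := fun v hv ↦ hK'R hv.1
  -- Now `U` moves to the side of `A` and `J` away from it. By `hJout` this removes `F₅` from the
  -- cut and creates no new cut edges inside `R`.
  have hlt₅ : F₅.ncard + nl (J ∩ Vl) + nr Vr < k := by
    have h1 := h.ncard_add_lt_of_cut_subset (Z := (A ∪ U) \ J) (N := J ∪ R \ A) hb
      (fun v hv ↦ ⟨Or.inl hv.1, fun hvJ ↦ h.left_disjoint v hv.2 (hJR hvJ)⟩)
      (by
        rintro v ⟨⟨hv | hv, -⟩, hvW⟩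
        · exact hv
        · exact absurd hvW (h.outer_disjoint v hv))
      (by
        rintro v ⟨⟨hv | hv, -⟩, hvr⟩
        · exact hv
        · exact absurd (h.right_subset hvr) (h.left_disjoint v hv))
      hF₅R (by
        rintro e ⟨a, b, hl, ⟨ha, haJ⟩, hb'⟩
        have hb'' : b ∈ J ∨ b ∉ A ∧ b ∉ U := by
          by_cases hbJ : b ∈ J
          · exact Or.inl hbJ
          · right
            rw [← not_or]
            exact fun hbAU ↦ hb' ⟨hbAU, hbJ⟩
        rcases h.cover e b a hl.symm with hbU | hbR | hbW
        · rcases hb'' with hbJ | hbAU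
          · exact absurd (hJR hbJ) (h.left_disjoint b hbU)
          · exact absurd hbU hbAU.2
        · rcases h.cover e a b hl with haU | haR | haW
          · refine Or.inr ⟨a, haU, b, ?_, hl⟩
            rcases hb'' with hbJ | hbAU
            · exact Or.inl hbJ
            · exact Or.inr ⟨hbR, hbAU.1⟩
          · have hlR : (H.induce R).IsLink e a b := isLink_induce.2 ⟨hl, haR, hbR⟩
            have haA : a ∈ A := ha.resolve_right fun haU ↦ h.left_disjoint a haU haR
            rcases hb'' with hbJ | hbAU
            · exact absurd haA (hJout e b a hlR.symm hbJ haJ).2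
            · refine Or.inl (Or.inl ⟨⟨a, b, hlR, haA, hbAU.1⟩, ?_⟩)
              rintro ⟨a', b', hl', ha', -⟩
              obtain ⟨rfl, rfl⟩ | ⟨rfl, rfl⟩ := hl'.eq_and_eq_or_eq_and_eq hlR
              · exact haJ ha'
              · exact hbAU.1 ha'.2
          · have haA : a ∈ A := ha.resolve_right fun haU ↦ h.outer_disjoint a haU haW
            rcases hb'' with hbJ | hbAU
            · exact absurd (h.mem_right e a b hl haW hbR) (hK'r b hbJ.1)
            · exact Or.inl (Or.inr ⟨⟨a, b, hl, haA, hbAU.1⟩, a, haW, hl.inc_left⟩)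
        · have haA : a ∈ A := ha.resolve_right fun haU ↦ h.not_isLink e a b hl haU hbW
          rcases hb'' with hbJ | hbAU
          · exact absurd (hJR hbJ) (h.right_disjoint b hbW)
          · exact Or.inl (Or.inr ⟨⟨a, b, hl, haA, hbAU.1⟩, b, hbW, hl.inc_right⟩))
    have h2 := heq J hJR
    have h3 := ncard_between_add h.finite h.left_disjoint hJR
    have h4 := ncard_between_add (U := U) (R := J ∪ R \ A) (Z := J) h.finite
      (fun v hv hv' ↦ h.left_disjoint v hv (hv'.elim (fun h ↦ hJR h) fun h ↦ h.1))
      Set.subset_union_left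
    have h5 : (J ∪ R \ A) \ J = R \ A := by
      rw [Set.union_sdiff_left]
      exact sdiff_eq_left.2 (Set.disjoint_left.2 fun v hv hv' ↦ hv.2 hv'.2)
    rw [h5] at h4
    have h6 := h.right_full
    omega
  have hmono : ∀ a b, Reachable ((G.induce R).deleteEdges FR) a b →
      Reachable ((G.induce R).deleteEdges F₅) a b := fun a b hr ↦ hr.mono hr.1 fun e a b hl ↦ by
    rw [isLink_deleteEdges] at hl ⊢
    exact ⟨hl.1, fun he ↦ hl.2 (hF₅R he)⟩
  have hmonoH : ∀ a b, Reachable ((H.induce R).deleteEdges FR) a b →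
      Reachable ((G.induce R).deleteEdges FR) a b := fun a b hr ↦ hr.mono hr.1 fun e a b hl ↦ by
    rw [isLink_deleteEdges] at hl ⊢
    exact ⟨hHG e a b hl.1, hl.2⟩
  have hxJ : x ∈ J := by
    refine ⟨?_, hxA⟩
    have hr := ((hmonoH _ _ hxu).trans huw).symm
    exact hr.mono hr.1 fun e a b hl ↦ by
      rw [isLink_deleteEdges] at hl ⊢
      exact ⟨hl.1, fun he ↦ hl.2 (hF₂R he)⟩
  obtain ⟨y, hy, hqy⟩ := h.left_reach q hq
  -- Follow a path from `y` back to `q`: outside `K'` it meets no edge of `F₅`, and it first enters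
  -- `K'` at a vertex of `K`, which `w` reaches without `FR`.
  have hwy : Reachable ((G.induce R).deleteEdges F₅) w y := by
    have hend := hqy.symm.mem_of_closed (B := {v |
        (v ∉ K' ∧ Reachable ((G.induce R).deleteEdges F₅) v y) ∨
          Reachable ((G.induce R).deleteEdges F₅) w y})
      (Or.inl ⟨fun hyK ↦ hK'r y hyK hy, .refl hqy.right_mem⟩) (by
        rintro e a b hl (⟨haK, har⟩ | ha)
        · have hstep : Reachable ((G.induce R).deleteEdges F₅) b a :=
            .of_isLink (isLink_deleteEdges.2 ⟨hl.symm, hF₅K e a b hl haK⟩)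
          by_cases hbK : b ∈ K'
          · right
            have hbK := hexit e b a hl.symm hbK haK
            exact (hmono _ _ (hmonoH _ _ hbK)).trans (hstep.trans har)
          · exact Or.inl ⟨hbK, hstep.trans har⟩
        · exact Or.inr ha)
    exact hend.resolve_left fun hc ↦ hc.1 (hKK' hwq)
  have hxy : Linked ((G.induce R).deleteEdges F₅) (J ∩ Vl) Vr :=
    ⟨x, ⟨hxJ, hx⟩, y, hy, (hmono _ _ ((hmonoH _ _ hxu).trans huw)).trans hwy⟩
  obtain ⟨z, hz, hzJ⟩ := (h.demand _ Set.inter_subset_right _ subset_rfl F₅ cut_subset hlt₅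
      hxy).exists_mem_of_closed Set.inter_subset_left fun e a b hl ha ↦ by
    rw [isLink_deleteEdges] at hl
    by_contra hb'
    exact hl.2 ⟨a, b, hl.1, ha, hb'⟩
  exact hK'r z hzJ.1 hz

/-- In a slab, `G` has no connection between the two sides of the cut of `A` that avoids the cut
of `A` in `H`, apart from vertices that `H` does not join to the boundary. -/
theorem not_reachable (h : Slab G H k A U R W Vl Vr nl nr) {a b : α}
    (ha : a ∈ Vl ∪ Vr) (haA : a ∈ A)
    (hau : Reachable ((H.induce R).deleteEdges (cut (H.induce R) A)) a u)
    (hb : b ∈ Vl ∪ Vr) (hbA : b ∉ A)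
    (hwb : Reachable ((H.induce R).deleteEdges (cut (H.induce R) A)) w b) :
    ¬ Reachable ((G.induce R).deleteEdges (cut (H.induce R) A)) u w := by
  intro huw
  have hHG : ∀ {x y}, Reachable ((H.induce R).deleteEdges (cut (H.induce R) A)) x y →
      Reachable ((G.induce R).deleteEdges (cut (H.induce R) A)) x y := fun hr ↦
    hr.mono hr.1 fun e x y hl ↦ by
      rw [isLink_induce_deleteEdges] at hl ⊢
      exact ⟨⟨h.isLink e x y hl.1.1, hl.1.2⟩, hl.2⟩
  have huA : u ∈ A := (mem_iff_of_reachable hau).1 haA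
  have hwA : w ∉ A := fun hw ↦ hbA ((mem_iff_of_reachable hwb).1 hw)
  by_cases hu : ∃ x ∈ Vl, Reachable ((H.induce R).deleteEdges (cut (H.induce R) A)) x u <;>
  by_cases hw : ∃ y ∈ Vr, Reachable ((H.induce R).deleteEdges (cut (H.induce R) A)) w y
  · obtain ⟨x, hx, hxu⟩ := hu
    obtain ⟨y, hy, hwy⟩ := hw
    refine h.not_reachable_of_same_side (X := A ∩ Vl) (Y := Aᶜ ∩ Vr) Set.inter_subset_right
      Set.inter_subset_right subset_rfl subset_rfl (fun x hx y hy hr ↦ ?_) x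
      ⟨(mem_iff_of_reachable hxu).2 huA, hx⟩ y
      ⟨fun hyA ↦ hwA ((mem_iff_of_reachable hwy).2 hyA), hy⟩
      ((hHG hxu).trans (huw.trans (hHG hwy)))
    exact hy.1 ((mem_iff_of_reachable hr).1 hx.1)
  · obtain ⟨x, hx, hxu⟩ := hu
    push Not at hw
    have hbl : b ∈ Vl := hb.resolve_right fun hbr ↦ hw b hbr hwb
    exact h.not_reachable_of_left_left hx ((mem_iff_of_reachable hxu).2 huA) hxu hbl hbA hwb hw huw
  · obtain ⟨y, hy, hwy⟩ := hw
    push Not at hu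
    have har : a ∈ Vr := ha.resolve_left fun hal ↦ hu a hal hau
    have := h.symm.not_reachable_of_left_left (x := y) (u := w) (q := a) (w := u) hy
      (fun hyA ↦ hwA ((mem_iff_of_reachable hwy).2 hyA))
    rw [cut_compl] at this
    exact this hwy.symm har (fun h ↦ h haA) hau.symm (fun x hx hr ↦ hu x hx hr.symm) huw.symm
  -- Crossed case: `a` lies on the right boundary and `b` on the left. Adding them to the two demand
  -- sets keeps these unlinked in `H`, while `G` would join `b` to `a`.
  · push Not at hu hw
    have har : a ∈ Vr := ha.resolve_left fun hal ↦ hu a hal hau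
    have hbl : b ∈ Vl := hb.resolve_right fun hbr ↦ hw b hbr hwb
    have hbu : ∀ x ∈ A ∩ Vl, ¬ Reachable ((H.induce R).deleteEdges (cut (H.induce R) A)) x a :=
      fun x hx hr ↦ hu x hx.2 (hr.trans hau)
    have hbw : ∀ y ∈ Aᶜ ∩ Vr, ¬ Reachable ((H.induce R).deleteEdges (cut (H.induce R) A)) b y :=
      fun y hy hr ↦ hw y hy.2 (hwb.trans hr)
    refine h.not_reachable_of_same_side (X := insert b (A ∩ Vl)) (Y := insert a (Aᶜ ∩ Vr))
      (Set.insert_subset hbl Set.inter_subset_right) (Set.insert_subset har Set.inter_subset_right)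
      (Set.subset_insert _ _) (Set.subset_insert _ _) ?_ b (Set.mem_insert _ _) a
      (Set.mem_insert _ _) (((hHG hau).trans (huw.trans (hHG hwb))).symm)
    rintro x (rfl | hx) y (rfl | hy) hr
    · exact hbA ((mem_iff_of_reachable hr).2 haA)
    · exact hbw y hy hr
    · exact hbu x hx hr
    · exact hy.1 ((mem_iff_of_reachable hr).1 hx.1)

end Slab

end Slab

/-! ### Demand values as deficits, and necessity for one component -/

section Demands

variable {α β : Type*} {G H : Graph α β} {s t : α} {C C' : Component α β} {U W U' W' : Set α}
  {c k : ℕ} {X Y : Set α} {F S : Set β}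

lemma edgeSet_induce_subset {P : Set α} : E(G.induce P) ⊆ E(G) := fun e he ↦ by
  obtain ⟨x, y, hl⟩ := Graph.exists_isLink_of_mem_edgeSet he
  exact (isLink_induce.1 hl).1.edge_mem

lemma induce_induce {P R : Set α} (h : R ⊆ P) : (G.induce P).induce R = G.induce R := by
  refine Graph.ext rfl fun e x y ↦ ?_
  simp only [isLink_induce]
  exact ⟨fun hl ↦ ⟨hl.1.1, hl.2⟩, fun hl ↦ ⟨⟨hl.1, h hl.2.1, h hl.2.2⟩, hl.2⟩⟩

/-- The edges of `S` that are not incident on `X`. -/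
def missedEdges (G : Graph α β) (S : Set β) (X : Set α) : Set β := S \ incidentEdges G S X

lemma mem_missedEdges {e : β} : e ∈ missedEdges G S X ↔ e ∈ S ∧ ∀ x ∈ X, ¬ G.Inc e x := by
  simp only [missedEdges, incidentEdges, Set.mem_sdiff, Set.mem_ofPred_eq]
  grind

lemma LeftPlaced.leftSep_subset (h : LeftPlaced G s C U) : C.leftSep ⊆ E(G) := fun e he ↦ by
  obtain ⟨x, -, y, -, hl⟩ := (h.mem_leftSep e).1 he
  exact hl.edge_mem

lemma LeftPlaced.missedEdges_left (h : LeftPlaced G s C U) :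
    missedEdges G C.leftSep C.left = ∅ := by
  ext e
  simp only [mem_missedEdges, Set.mem_empty_iff_false, iff_false, not_and, not_forall, not_not]
  intro he
  obtain ⟨x, hx, y, hy, hl⟩ := (h.mem_leftSep e).1 he
  exact ⟨y, h.mem_left e x y hl hx hy, hl.inc_right⟩

/-- Each separator splits into incident and missed edges, so the demand is `k` minus two deficits;
the strict inequality absorbs the truncation at `0`. -/
lemma lt_demandValue_iff (hE : E(G).Finite) (hp : Placed G s t C U W) {n : ℕ} :
    n < demandValue G k C X Y ↔
      n + (missedEdges G C.leftSep X).ncard + (missedEdges G C.rightSep Y).ncard < k := by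
  have h : ∀ (S : Set β) (Z : Set α), S ⊆ E(G) →
      (missedEdges G S Z).ncard + (incidentEdges G S Z).ncard = S.ncard := fun S Z hS ↦
    Set.ncard_sdiff_add_ncard_of_subset (fun e he ↦ he.1) (hE.subset hS)
  have h1 := h C.leftSep X hp.toLeft.leftSep_subset
  have h2 := h C.rightSep Y hp.toRight.leftSep_subset
  unfold demandValue
  omega

lemma LeftPlaced.reachable_left (h : LeftPlaced G s C U) (hC : C.left ⊆ C.verts)
    (hCV : C.verts ⊆ V(G)) {x : α} (hx : x ∈ C.left)
    (hF : ∀ e a b, G.IsLink e a b → a ∈ U → b ∈ U ∨ b = x → e ∉ F) :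
    Reachable (G.deleteEdges F) s x := by
  rcases h.attached x hx with rfl | ⟨u, hu, e, hl⟩
  · exact .refl (hCV (hC hx))
  · have hr := h.reach e u x hl hu (hC hx)
    have hsV : Reachable (G.deleteEdges F) u s := by
      refine hr.symm.mono hl.left_mem fun f a b hab ↦ ?_
      rw [isLink_induce] at hab
      exact isLink_deleteEdges.2 ⟨hab.1, hF f a b hab.1 hab.2.1 (Or.inl hab.2.2)⟩
    exact hsV.symm.tail (isLink_deleteEdges.2 ⟨hl, hF e u x hl hu (Or.inr rfl)⟩)

lemma IsFeasibleSD.linked (hH : H ≤s G) (hfeas : IsFeasibleSD G H s t k)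
    (hp : Placed G s t C U W) (hwl : WellLinked G C c) (hX : X ⊆ C.left) (hY : Y ⊆ C.right)
    (hF : F ⊆ E(G.induce C.verts))
    (hlt : F.ncard + (missedEdges G C.leftSep X).ncard + (missedEdges G C.rightSep Y).ncard < k)
    (hl : Linked ((G.induce C.verts).deleteEdges F) X Y) :
    Linked ((H.induce C.verts).deleteEdges F) X Y := by
  set F' := F ∪ missedEdges G C.leftSep X ∪ missedEdges G C.rightSep Y with hF'
  have hF'E : F' ⊆ E(G) := Set.union_subset (Set.union_subset (hF.trans edgeSet_induce_subset)
    (Set.sdiff_subset.trans hp.toLeft.leftSep_subset))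
    (Set.sdiff_subset.trans hp.toRight.leftSep_subset)
  have hcard : F'.ncard < k := by
    rw [hF']
    have h1 := Set.ncard_union_le (F ∪ missedEdges G C.leftSep X) (missedEdges G C.rightSep Y)
    have h2 := Set.ncard_union_le F (missedEdges G C.leftSep X)
    omega
  have hFin : ∀ e ∈ F, ∀ a b, G.IsLink e a b → a ∈ C.verts := by
    intro e he a b hab
    obtain ⟨x, y, hxy⟩ := Graph.exists_isLink_of_mem_edgeSet (hF he)
    rw [isLink_induce] at hxy
    obtain ⟨rfl, rfl⟩ | ⟨rfl, rfl⟩ := hab.eq_and_eq_or_eq_and_eq hxy.1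
    · exact hxy.2.1
    · exact hxy.2.2
  have hFl : ∀ x ∈ X, ∀ e a b, G.IsLink e a b → a ∈ U → b ∈ U ∨ b = x → e ∉ F' := by
    rintro x hx e a b hab ha hb ((he | he) | he)
    · exact hp.left_disjoint a ha (hFin e he a b hab)
    · obtain ⟨he, hno⟩ := mem_missedEdges.1 he
      rcases hb with hb | rfl
      · obtain ⟨p, hp', q, hq, hpq⟩ := (hp.toLeft.mem_leftSep e).1 he
        obtain ⟨rfl, rfl⟩ | ⟨rfl, rfl⟩ := hab.eq_and_eq_or_eq_and_eq hpq
        · exact hp.left_disjoint _ hb hq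
        · exact hp.left_disjoint _ ha hq
      · exact hno _ hx hab.inc_right
    · obtain ⟨p, hp', q, hq, hpq⟩ := (hp.toRight.mem_leftSep e).1 (mem_missedEdges.1 he).1
      obtain ⟨rfl, rfl⟩ | ⟨rfl, rfl⟩ := hab.eq_and_eq_or_eq_and_eq hpq
      · exact hp.outer_disjoint _ ha hp'
      · exact hp.left_disjoint _ ha hq
  have hFr : ∀ y ∈ Y, ∀ e a b, G.IsLink e a b → a ∈ W → b ∈ W ∨ b = y → e ∉ F' := by
    rintro y hy e a b hab ha hb ((he | he) | he)
    · exact hp.right_disjoint a ha (hFin e he a b hab)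
    · obtain ⟨p, hp', q, hq, hpq⟩ := (hp.toLeft.mem_leftSep e).1 (mem_missedEdges.1 he).1
      obtain ⟨rfl, rfl⟩ | ⟨rfl, rfl⟩ := hab.eq_and_eq_or_eq_and_eq hpq
      · exact hp.outer_disjoint _ hp' ha
      · exact hp.right_disjoint _ ha hq
    · obtain ⟨he, hno⟩ := mem_missedEdges.1 he
      rcases hb with hb | rfl
      · obtain ⟨p, hp', q, hq, hpq⟩ := (hp.toRight.mem_leftSep e).1 he
        obtain ⟨rfl, rfl⟩ | ⟨rfl, rfl⟩ := hab.eq_and_eq_or_eq_and_eq hpq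
        · exact hp.right_disjoint _ hb hq
        · exact hp.right_disjoint _ ha hq
      · exact hno _ hy hab.inc_right
  obtain ⟨x, hx, y, hy, hxy⟩ := hl
  have hsx := hp.toLeft.reachable_left hwl.left_subset hp.verts_subset (hX hx)
    (hFl x hx)
  have hty := hp.toRight.reachable_left hwl.right_subset hp.verts_subset
    (show y ∈ C.rev.left from hY hy) (hFr y hy)
  have hxy' : Reachable (G.deleteEdges F') x y := by
    refine hxy.mono hsx.right_mem fun e a b hab ↦ ?_
    rw [isLink_induce_deleteEdges] at hab
    refine isLink_deleteEdges.2 ⟨hab.1.1, ?_⟩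
    rintro ((he | he) | he)
    · exact hab.2 he
    · obtain ⟨p, hp', q, hq, hpq⟩ := (hp.toLeft.mem_leftSep e).1 (mem_missedEdges.1 he).1
      obtain ⟨rfl, rfl⟩ | ⟨rfl, rfl⟩ := hab.1.1.eq_and_eq_or_eq_and_eq hpq
      · exact hp.left_disjoint _ hp' hab.1.2.1
      · exact hp.left_disjoint _ hp' hab.1.2.2
    · obtain ⟨p, hp', q, hq, hpq⟩ := (hp.toRight.mem_leftSep e).1 (mem_missedEdges.1 he).1
      obtain ⟨rfl, rfl⟩ | ⟨rfl, rfl⟩ := hab.1.1.eq_and_eq_or_eq_and_eq hpq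
      · exact hp.right_disjoint _ hp' hab.1.2.1
      · exact hp.right_disjoint _ hp' hab.1.2.2
  have hst := hfeas F' hF'E hcard (hsx.trans (hxy'.trans hty.symm))
  by_contra hno
  rw [not_linked_iff] at hno
  have hXC : X ⊆ C.verts := hX.trans hwl.left_subset
  have hBC : reachSet ((H.induce C.verts).deleteEdges F) X ⊆ C.verts :=
    fun v hv ↦ reachSet_subset_vertexSet hv
  -- If `H` did not link `X` to `Y`, this set would be closed: the deleted left edges block entry
  -- outside `X`, and every right separator edge at a reached vertex misses `Y`, hence is deleted.
  have htB := hst.mem_of_closed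
    (B := U ∪ reachSet ((H.induce C.verts).deleteEdges F) X) (by
      rcases hp.toLeft.source with hs | hs
      · exact Or.inl hs
      · obtain rfl : x = s := by have := hX hx; rwa [hs] at this
        exact Or.inr (subset_reachSet hXC hx)) (by
      intro e a b hab ha
      rw [isLink_deleteEdges] at hab
      have habG := hab.1.mono hH.le
      rcases hp.cover b habG.right_mem with hb | hb | hb
      · exact Or.inl hb
      · right
        rcases ha with ha | ha
        · have he : e ∈ C.leftSep := (hp.toLeft.mem_leftSep e).2 ⟨a, ha, b, hb, habG⟩
          have hbX : b ∈ X := by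
            by_contra hbX
            refine hab.2 (Or.inl (Or.inr (mem_missedEdges.2 ⟨he, fun z hz hze ↦ ?_⟩)))
            obtain rfl | rfl := hze.eq_or_eq_of_isLink habG
            · exact hp.left_disjoint _ ha (hXC hz)
            · exact hbX hz
          exact subset_reachSet hXC hbX
        · exact reachSet_closed e a b (isLink_induce_deleteEdges.2
            ⟨⟨hab.1, hBC ha, hb⟩, fun he ↦ hab.2 (Or.inl (Or.inl he))⟩) ha
      · rcases ha with ha | ha
        · exact absurd hb (hp.not_isLink e a b habG ha)
        · exfalso
          have he : e ∈ C.rightSep :=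
            (hp.toRight.mem_leftSep e).2 ⟨b, hb, a, hBC ha, habG.symm⟩
          refine hab.2 (Or.inr (mem_missedEdges.2 ⟨he, fun z hz hze ↦ ?_⟩))
          obtain rfl | rfl := hze.eq_or_eq_of_isLink habG
          · exact hno _ hz ha
          · exact hp.right_disjoint _ hb (hwl.right_subset (hY hz)))
  rcases hp.toRight.source with ht | ht
  · rcases htB with htB | htB
    · exact hp.outer_disjoint t htB ht
    · exact hp.right_disjoint t ht (hBC htB)
  · obtain rfl : y = t := by
      have h' : y ∈ C.rev.left := hY hy
      rwa [ht] at h'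
    rcases htB with htB | htB
    · exact hp.left_disjoint _ htB (hwl.right_subset (hY hy))
    · exact hno y hy htB

lemma IsFeasibleSD.symm (h : IsFeasibleSD G H s t k) : IsFeasibleSD G H t s k :=
  fun F hF hlt hr ↦ (h F hF hlt hr.symm).symm

/-- With the other edges of the separator deleted, `e` is the only way out of `U`, and `G` still has
an `s`–`t` path through it. -/
lemma IsFeasibleSD.leftSep_subset (hH : H ≤s G) (hE : E(G).Finite)
    (hfeas : IsFeasibleSD G H s t k) (hp : Placed G s t C U W) (hwl : WellLinked G C c)
    (hlt : C.leftSep.ncard < k) : C.leftSep ⊆ E(H) := by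
  intro e he
  obtain ⟨x, hx, y, hy, hl⟩ := (hp.toLeft.mem_leftSep e).1 he
  have hsU := (hp.toLeft.reach e x y hl hx hy).1
  have hyl := hp.toLeft.mem_left e x y hl hx hy
  obtain ⟨r, hr, hyr⟩ := hwl.left_reach y hyl
  set F := C.leftSep \ {e} with hF
  have hFU : ∀ f ∈ F, ∀ a b, G.IsLink f a b → (a ∈ U ∧ b ∈ C.verts) ∨ (b ∈ U ∧ a ∈ C.verts) := by
    intro f hf a b hab
    obtain ⟨p, hp', q, hq, hpq⟩ := (hp.toLeft.mem_leftSep f).1 hf.1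
    obtain ⟨rfl, rfl⟩ | ⟨rfl, rfl⟩ := hab.eq_and_eq_or_eq_and_eq hpq
    · exact Or.inl ⟨hp', hq⟩
    · exact Or.inr ⟨hp', hq⟩
  have hle : F.ncard ≤ C.leftSep.ncard :=
    Set.ncard_le_ncard Set.sdiff_subset (hE.subset hp.toLeft.leftSep_subset)
  have hrs : Reachable (G.deleteEdges F) x s := by
    refine (hp.toLeft.reach e x y hl hx hy).symm.mono hl.left_mem fun f a b hab ↦ ?_
    rw [isLink_induce] at hab
    refine isLink_deleteEdges.2 ⟨hab.1, fun hf ↦ ?_⟩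
    rcases hFU f hf a b hab.1 with h | h
    · exact hp.left_disjoint b hab.2.2 h.2
    · exact hp.left_disjoint a hab.2.1 h.2
  have hxy : Reachable (G.deleteEdges F) x y :=
    .of_isLink (isLink_deleteEdges.2 ⟨hl, fun hf ↦ hf.2 rfl⟩)
  have hyr' : Reachable (G.deleteEdges F) y r := by
    refine hyr.mono hl.right_mem fun f a b hab ↦ ?_
    rw [isLink_induce] at hab
    refine isLink_deleteEdges.2 ⟨hab.1, fun hf ↦ ?_⟩
    rcases hFU f hf a b hab.1 with h | h
    · exact hp.left_disjoint a h.1 hab.2.1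
    · exact hp.left_disjoint b h.1 hab.2.2
  have htr := hp.toRight.reachable_left (F := F) hwl.right_subset hp.verts_subset
    (show r ∈ C.rev.left from hr) (by
      intro f a b hab ha hb hf
      rcases hFU f hf a b hab with h | h
      · exact hp.outer_disjoint a h.1 ha
      · exact hp.right_disjoint a ha h.2)
  have hst := hfeas F (Set.sdiff_subset.trans hp.toLeft.leftSep_subset) (hle.trans_lt hlt)
    (hrs.symm.trans (hxy.trans (hyr'.trans htr.symm)))
  by_contra heH
  have htU := hst.mem_of_closed (B := U) hsU (by
    intro f a b hab ha
    rw [isLink_deleteEdges] at hab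
    have habG := hab.1.mono hH.le
    rcases hp.cover b habG.right_mem with hb | hb | hb
    · exact hb
    · have hf : f ∈ C.leftSep := (hp.toLeft.mem_leftSep f).2 ⟨a, ha, b, hb, habG⟩
      refine absurd ⟨hf, ?_⟩ hab.2
      rintro rfl
      exact heH hab.1.edge_mem
    · exact absurd hb (hp.not_isLink f a b habG ha))
  rcases hp.toRight.source with ht | ht
  · exact hp.outer_disjoint t htU ht
  · refine hp.left_disjoint t htU (hwl.right_subset ?_)
    have : C.right = {t} := ht
    rw [this]; rfl

/-! ### Sufficiency for one chain -/

lemma Refines.symm (h : Refines G c C U W C' U' W') : Refines G c C.rev W U C'.rev W' U' where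
  verts_subset := h.verts_subset
  left_subset := h.right_subset
  right_subset := h.left_subset
  left := h.right
  right := h.left

/-- If the left boundary is inherited, it lies in `A`. Otherwise the left separator has `c` edges,
all in `H[C.verts]`, and every admissible `Z` contains `C.left` and avoids `C.right`, so `hlink`
gives its cut at least `c` edges. -/
lemma Refines.deficitBound (hH : H ≤s G) (hE : E(G).Finite) (hp : Placed G s t C' U' W')
    (hwl' : WellLinked G C' (c + 1)) (hwl : WellLinked G C c) (href : Refines G c C U W C' U' W')
    (hlink : ∀ T : Set β, T ⊆ E(H.induce C.verts) → T.ncard < c →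
      Linked ((H.induce C.verts).deleteEdges T) C.left C.right)
    (hsep : C'.leftSep ⊆ E(H)) {A : Set α} (hlA : C.left ⊆ A) (hrA : ∀ v ∈ C.right, v ∉ A) :
    DeficitBound (H.induce C.verts) A (U' ∩ C.verts) C'.verts (W' ∩ C.verts) C'.left C'.right
      fun X ↦ (missedEdges G C'.leftSep X).ncard := by
  rcases href.left with ⟨hl, -⟩ | ⟨hl, hcard, hSE⟩
  · exact Or.inl (hl ▸ hlA)
  refine Or.inr ⟨fun Z _ ↦ ?_, fun Z hZU hZW hZr ↦ ?_⟩
  · refine congrArg Set.ncard (Set.ext fun e ↦ ?_)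
    rw [mem_missedEdges]
    constructor
    · rintro ⟨he, hno⟩
      obtain ⟨x, hx, y, hy, hl⟩ := (hp.toLeft.mem_leftSep e).1 he
      have hyl := hp.toLeft.mem_left e x y hl hx hy
      obtain ⟨p, q, hpq⟩ := Graph.exists_isLink_of_mem_edgeSet (hSE he)
      rw [isLink_induce] at hpq
      have hxC : x ∈ C.verts := by
        obtain ⟨rfl, rfl⟩ | ⟨rfl, rfl⟩ := hl.eq_and_eq_or_eq_and_eq hpq.1
        · exact hpq.2.1
        · exact hpq.2.2
      exact ⟨x, ⟨hx, hxC⟩, y, ⟨hy, fun hyZ ↦ hno y ⟨hyZ, hyl⟩ hl.inc_right⟩,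
        isLink_induce.2 ⟨(hH.le.isLink_iff (hsep he)).2 hl, hxC, href.verts_subset hy⟩⟩
    · rintro ⟨x, hx, y, hy, hl⟩
      have hlG := (isLink_induce.1 hl).1.mono hH.le
      refine ⟨(hp.toLeft.mem_leftSep e).2 ⟨x, hx.1, y, hy.1, hlG⟩, fun z hz hze ↦ ?_⟩
      obtain rfl | rfl := hze.eq_or_eq_of_isLink hlG
      · exact hp.left_disjoint _ hx.1 (hwl'.left_subset hz.2)
      · exact hy.2 hz.1
  · have hle : (between (H.induce C.verts) (U' ∩ C.verts) C'.verts).ncard ≤ C'.leftSep.ncard := by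
      refine Set.ncard_le_ncard ?_ (hE.subset hp.toLeft.leftSep_subset)
      rintro e ⟨x, hx, y, hy, hl⟩
      exact (hp.toLeft.mem_leftSep e).2 ⟨x, hx.1, y, hy, (isLink_induce.1 hl).1.mono hH.le⟩
    by_contra hlt
    obtain ⟨y, hy, hyZ⟩ := (hlink (cut (H.induce C.verts) Z) cut_subset
      (by omega)).exists_mem_of_closed (B := Z)
      (fun v hv ↦ hZU ⟨hlA hv, hl hv, hwl.left_subset hv⟩) (by
        intro e a b hab ha
        rw [isLink_deleteEdges] at hab
        by_contra hb
        exact hab.2 ⟨a, b, hab.1, ha, hb⟩)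
    rcases href.right with ⟨hr, -⟩ | ⟨hr, -⟩
    · exact hrA y hy (hZr ⟨hyZ, hr ▸ hy⟩)
    · exact hrA y hy (hZW ⟨hyZ, hr hy, hwl.right_subset hy⟩)

lemma Refines.slab (hH : H ≤s G) (hE : E(G).Finite) (hp : Placed G s t C' U' W')
    (hwl' : WellLinked G C' (c + 1)) (hwl : WellLinked G C c) (href : Refines G c C U W C' U' W')
    (hCV : C.verts ⊆ V(G))
    (hlink : ∀ T : Set β, T ⊆ E(H.induce C.verts) → T.ncard < c →
      Linked ((H.induce C.verts).deleteEdges T) C.left C.right)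
    (hsepl : C'.leftSep ⊆ E(H)) (hsepr : C'.rightSep ⊆ E(H))
    (hdem : ∀ X ⊆ C'.left, ∀ Y ⊆ C'.right, SatisfiesDemand (G.induce C'.verts)
      (H.induce C'.verts) X Y (demandValue G k C' X Y))
    {A : Set α} (hlA : C.left ⊆ A) (hrA : ∀ v ∈ C.right, v ∉ A)
    (hlt : (cut (H.induce C.verts) A).ncard < k) :
    Slab (G.induce C.verts) (H.induce C.verts) k A (U' ∩ C.verts) C'.verts (W' ∩ C.verts)
      C'.left C'.right (fun X ↦ (missedEdges G C'.leftSep X).ncard)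
      (fun X ↦ (missedEdges G C'.rightSep X).ncard) where
  isLink e x y hl := by
    rw [isLink_induce] at hl ⊢
    exact ⟨hl.1.mono hH.le, hl.2⟩
  finite := hE.subset (edgeSet_induce_subset.trans (hH.le.edgeSet_mono))
  cover e x y hl := by
    rw [isLink_induce] at hl
    have := hp.cover x (hCV hl.2.1)
    simp only [Set.mem_inter_iff]
    tauto
  left_disjoint v hv := hp.left_disjoint v hv.1
  right_disjoint v hv := hp.right_disjoint v hv.1
  outer_disjoint v hv hv' := hp.outer_disjoint v hv.1 hv'.1
  not_isLink e x y hl hx hy :=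
    hp.not_isLink e x y ((isLink_induce.1 hl).1.mono hH.le) hx.1 hy.1
  left_subset := hwl'.left_subset
  right_subset := hwl'.right_subset
  mem_left e x y hl hx hy := hp.toLeft.mem_left e x y ((isLink_induce.1 hl).1.mono hH.le) hx.1 hy
  mem_right e x y hl hx hy :=
    hp.toRight.mem_left e x y ((isLink_induce.1 hl).1.mono hH.le) hx.1 hy
  left_anti X X' h := Set.ncard_le_ncard (fun e he ↦ by
    rw [mem_missedEdges] at he ⊢
    exact ⟨he.1, fun x hx ↦ he.2 x (h hx)⟩)
    (hE.subset (Set.sdiff_subset.trans hp.toLeft.leftSep_subset))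
  right_anti X X' h := Set.ncard_le_ncard (fun e he ↦ by
    rw [mem_missedEdges] at he ⊢
    exact ⟨he.1, fun x hx ↦ he.2 x (h hx)⟩)
    (hE.subset (Set.sdiff_subset.trans hp.toRight.leftSep_subset))
  left_full := by rw [hp.toLeft.missedEdges_left, Set.ncard_empty]
  right_full := by
    have := hp.toRight.missedEdges_left
    simp only [Component.rev] at this
    rw [this, Set.ncard_empty]
  left_bound := href.deficitBound hH hE hp hwl' hwl hlink hsepl hlA hrA
  right_bound := href.symm.deficitBound hH hE hp.symm hwl'.symm hwl.symm
    (fun T hT hTc ↦ (hlink T hT hTc).symm) hsepr hrA (fun v hv hv' ↦ hv' (hlA hv))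
  left_reach x hx := by
    rw [induce_induce href.verts_subset]
    exact hwl'.left_reach x hx
  right_reach y hy := by
    rw [induce_induce href.verts_subset]
    obtain ⟨x, hx, hr⟩ := hwl'.right_reach y hy
    exact ⟨x, hx, hr.symm⟩
  demand X hX Y hY F hF hFlt hl := by
    rw [induce_induce href.verts_subset] at hF hl ⊢
    refine hdem X hX Y hY F (fun e he ↦ ?_) ((lt_demandValue_iff hE hp).2 hFlt) hl
    obtain ⟨x, y, hl⟩ := Graph.exists_isLink_of_mem_edgeSet (hF he)
    rw [isLink_induce] at hl
    exact (isLink_induce.2 ⟨hl.1.mono hH.le, hl.2⟩).edge_mem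
  ncard_cut_lt := hlt

/-- If the components of a chain of `C` satisfy their demands, then `C` satisfies the demand `k`
between its boundary sets. -/
theorem IsChain.satisfiesDemand (hH : H ≤s G) (hV : V(G).Finite) (hE : E(G).Finite)
    {L : List (Component α β)} (hc : 1 ≤ c) (hch : IsChain G c C L) (hp : Placed G s t C U W)
    (hwl : WellLinked G C c)
    (hdemc : SatisfiesDemand (G.induce C.verts) (H.induce C.verts) C.left C.right c)
    (hsep : ∀ C' ∈ L, C'.leftSep ⊆ E(H) ∧ C'.rightSep ⊆ E(H))
    (hdem : ∀ C' ∈ L, ∀ X ⊆ C'.left, ∀ Y ⊆ C'.right, SatisfiesDemand (G.induce C'.verts)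
      (H.induce C'.verts) X Y (demandValue G k C' X Y)) :
    SatisfiesDemand (G.induce C.verts) (H.induce C.verts) C.left C.right k := by
  intro F hF hFk
  contrapose
  intro hno
  obtain ⟨hcov, hch⟩ := hch.refines hV hE hc hp hwl
  have hHE : E(H.induce C.verts) ⊆ E(G.induce C.verts) := fun e he ↦ by
    obtain ⟨x, y, hl⟩ := Graph.exists_isLink_of_mem_edgeSet he
    rw [isLink_induce] at hl
    exact (isLink_induce.2 ⟨hl.1.mono hH.le, hl.2⟩).edge_mem
  have hGfin : E(G.induce C.verts).Finite := hE.subset edgeSet_induce_subset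
  have hlink : ∀ T : Set β, T ⊆ E(H.induce C.verts) → T.ncard < c →
      Linked ((H.induce C.verts).deleteEdges T) C.left C.right := fun T hT hTc ↦
    hdemc T (hT.trans hHE) hTc (hwl.linked T (hGfin.subset (hT.trans hHE)) hTc)
  rw [not_linked_iff] at hno
  set A := reachSet ((H.induce C.verts).deleteEdges F) C.left with hA
  have hlA : C.left ⊆ A := subset_reachSet hwl.left_subset
  have hAcl : ∀ e a b, (H.induce C.verts).IsLink e a b → e ∉ F → a ∈ A → b ∈ A :=
    fun e a b hl he ha ↦ reachSet_closed e a b (isLink_deleteEdges.2 ⟨hl, he⟩) ha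
  have hcutF : cut (H.induce C.verts) A ⊆ F := by
    rintro e ⟨a, b, hl, ha, hb⟩
    by_contra he
    exact hb (hAcl e a b hl he ha)
  have hcutlt : (cut (H.induce C.verts) A).ncard < k :=
    (Set.ncard_le_ncard hcutF (hGfin.subset hF)).trans_lt hFk
  -- A path of `H` from `C.left` last enters `C'` at a boundary vertex, or starts there; from then
  -- on it stays in `C'` and in `A`.
  have htouch : ∀ a ∈ A, ∀ C' ∈ L, a ∈ C'.verts → ∃ v ∈ C'.left ∪ C'.right, v ∈ A ∧
      Reachable (((H.induce C.verts).induce C'.verts).deleteEdges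
        (cut ((H.induce C.verts).induce C'.verts) A)) v a := by
    rintro a ⟨l, hl, hr⟩
    refine (hr.mem_of_closed (B := {a | a ∈ A ∧ ∀ C' ∈ L, a ∈ C'.verts →
      ∃ v ∈ C'.left ∪ C'.right, v ∈ A ∧
      Reachable (((H.induce C.verts).induce C'.verts).deleteEdges
        (cut ((H.induce C.verts).induce C'.verts) A)) v a}) ⟨hlA hl, fun C' hC' hlC ↦ ?_⟩ ?_).2
    · obtain ⟨U', W', hp', hwl', href⟩ := hch C' hC'
      rcases href.left with ⟨h, -⟩ | ⟨h, -⟩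
      · exact ⟨l, Or.inl (h ▸ hl), hlA hl, .refl hlC⟩
      · exact absurd hlC (hp'.left_disjoint l (h hl))
    · rintro e a b hab ⟨ha, hav⟩
      rw [isLink_deleteEdges] at hab
      have hb := hAcl e a b hab.1 hab.2 ha
      refine ⟨hb, fun C' hC' hbC ↦ ?_⟩
      obtain ⟨U', W', hp', hwl', href⟩ := hch C' hC'
      have hab' := isLink_induce.1 hab.1
      have habG := hab'.1.mono hH.le
      rcases hp'.cover a habG.left_mem with haU | haC | haW
      · exact ⟨b, Or.inl (hp'.toLeft.mem_left e a b habG haU hbC), hb, .refl hbC⟩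
      · obtain ⟨v, hv, hvA, hva⟩ := hav C' hC' haC
        exact ⟨v, hv, hvA, hva.tail (isLink_deleteEdges.2
          ⟨isLink_induce.2 ⟨hab.1, haC, hbC⟩, fun he ↦ hab.2 (hcutF (cut_induce_subset he))⟩)⟩
      · exact ⟨b, Or.inr (hp'.toRight.mem_left e a b habG haW hbC), hb, .refl hbC⟩
  have hsame : ∀ C' ∈ L, ∀ a ∈ A, a ∈ C'.verts → ∀ x ∈ C'.left ∪ C'.right,
      Reachable (((G.induce C.verts).induce C'.verts).deleteEdges
        (cut ((H.induce C.verts).induce C'.verts) A)) a x → x ∈ A := by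
    intro C' hC' a ha haC x hx hax
    by_contra hxA
    obtain ⟨U', W', hp', hwl', href⟩ := hch C' hC'
    obtain ⟨v, hv, hvA, hva⟩ := htouch a ha C' hC' haC
    exact (href.slab hH hE hp' hwl' hwl hp.verts_subset hlink (hsep C' hC').1 (hsep C' hC').2
      (hdem C' hC') hlA hno hcutlt).not_reachable hv hvA hva hx hxA (.refl hax.right_mem) hax
  intro hlinkG
  -- This set contains everything `G` reaches without `F`. Inside a component reachability just
  -- continues; an edge leaving a component belongs to `H` and starts in `A` by `hsame`, so its
  -- other end is in `A` again.
  obtain ⟨y, hy, C', hC', hyC, a, ha, haC, hay⟩ := hlinkG.exists_mem_of_closed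
    (B := {x | ∃ C' ∈ L, x ∈ C'.verts ∧ ∃ a ∈ A, a ∈ C'.verts ∧
      Reachable (((G.induce C.verts).induce C'.verts).deleteEdges
        (cut ((H.induce C.verts).induce C'.verts) A)) a x})
    (fun x hx ↦ by
      obtain ⟨C', hC', hxC⟩ := hcov x (hwl.left_subset hx)
      exact ⟨C', hC', hxC, x, hlA hx, hxC, .refl hxC⟩) (by
      rintro e x y hxy ⟨C', hC', hxC, a, ha, haC, hax⟩
      obtain ⟨U', W', hp', hwl', href⟩ := hch C' hC'
      rw [isLink_deleteEdges] at hxy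
      have hxy' : G.IsLink e x y ∧ x ∈ C.verts ∧ y ∈ C.verts := isLink_induce.1 hxy.1
      by_cases hyC : y ∈ C'.verts
      · exact ⟨C', hC', hyC, a, ha, haC, hax.tail (isLink_deleteEdges.2
          ⟨isLink_induce.2 ⟨hxy.1, hxC, hyC⟩, fun he ↦ hxy.2 (hcutF (cut_induce_subset he))⟩)⟩
      · have hbd : x ∈ C'.left ∪ C'.right ∧ e ∈ E(H) := by
          rcases hp'.cover y hxy'.1.right_mem with hyU | h | hyW
          · exact ⟨Or.inl (hp'.toLeft.mem_left e y x hxy'.1.symm hyU hxC), (hsep C' hC').1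
              ((hp'.toLeft.mem_leftSep e).2 ⟨y, hyU, x, hxC, hxy'.1.symm⟩)⟩
          · exact absurd h hyC
          · exact ⟨Or.inr (hp'.toRight.mem_left e y x hxy'.1.symm hyW hxC), (hsep C' hC').2
              ((hp'.toRight.mem_leftSep e).2 ⟨y, hyW, x, hxC, hxy'.1.symm⟩)⟩
        have hxA := hsame C' hC' a ha haC x hbd.1 hax
        have hyA := hAcl e x y
          (isLink_induce.2 ⟨(hH.le.isLink_iff hbd.2).2 hxy'.1, hxy'.2⟩) hxy.2 hxA
        obtain ⟨C'', hC'', hyC''⟩ := hcov y hxy'.2.2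
        exact ⟨C'', hC'', hyC'', y, hyA, hyC'', .refl hyC''⟩)
  obtain ⟨U', W', hp', hwl', href⟩ := hch C' hC'
  rcases href.right with ⟨h, -⟩ | ⟨h, -⟩
  · exact hno y hy (hsame C' hC' a ha haC y (Or.inr (h ▸ hy)) hay)
  · exact hp'.right_disjoint y (h hy) hyC

end Demands

/-! ### Induction over the levels of the decomposition -/

section Hierarchy

variable {α β : Type*} {G H : Graph α β} {s t : α} {k : ℕ}

lemma placed_rootComponent :
    Placed G s t (rootComponent G s t) ∅ ∅ where
  toLeft := ⟨by simp [rootComponent], by simp, Or.inr rfl, fun x hx ↦ Or.inl hx, by simp⟩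
  toRight := ⟨by simp [rootComponent, Component.rev], by simp, Or.inr rfl,
    fun x hx ↦ Or.inl hx, by simp⟩
  cover v hv := Or.inr (Or.inl hv)
  verts_subset := subset_rfl
  left_disjoint := by simp
  right_disjoint := by simp
  outer_disjoint := by simp
  not_isLink := by simp

lemma TwoEdgeConnected.wellLinked (hG : TwoEdgeConnected G) (hs : s ∈ V(G)) (ht : t ∈ V(G)) :
    WellLinked G (rootComponent G s t) 2 where
  left_subset := by simpa [rootComponent] using hs
  right_subset := by simpa [rootComponent] using ht
  linked T hT hTc := by
    refine ⟨s, rfl, t, rfl, ?_⟩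
    simp only [rootComponent, Graph.induce_vertexSet]
    -- `T` need not consist of edges of `G`: either it is a single edge, or deleting it changes
    -- nothing.
    by_cases hTE : ∃ e ∈ T, e ∈ E(G)
    · obtain ⟨e, heT, he⟩ := hTE
      have hTe : T = {e} := by
        have h1 : 0 < T.ncard := (Set.ncard_pos hT).2 ⟨e, heT⟩
        obtain ⟨f, rfl⟩ := Set.ncard_eq_one.1 (show T.ncard = 1 by omega)
        rw [Set.mem_singleton_iff.1 heT]
      rw [hTe]
      exact (hG.2 e he).2 s hs t ht
    · push Not at hTE
      refine (hG.1.2 s hs t ht).mono hs fun e a b hl ↦ ?_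
      exact isLink_deleteEdges.2 ⟨hl, fun he ↦ hTE e he hl.edge_mem⟩
  left_reach x hx := by
    obtain rfl : x = s := hx
    refine ⟨t, rfl, ?_⟩
    simp only [rootComponent, Graph.induce_vertexSet]
    exact hG.1.2 x hs t ht
  right_reach x hx := by
    obtain rfl : x = t := hx
    refine ⟨s, rfl, ?_⟩
    simp only [rootComponent, Graph.induce_vertexSet]
    exact hG.1.2 s hs x ht

lemma exists_chain_of_mem {h : ℕ} {l : List (Component α β)} {chains : List (List (Component α β))}
    (hl : List.Forall₂ (IsChain G h) l chains) :
    (∀ C ∈ l, ∃ L, IsChain G h C L ∧ L ⊆ chains.flatten) ∧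
      ∀ C' ∈ chains.flatten, ∃ C ∈ l, ∃ L, IsChain G h C L ∧ C' ∈ L := by
  induction hl with
  | nil => simp
  | @cons C L l chains hC hl ih =>
    refine ⟨fun D hD ↦ ?_, fun C' hC' ↦ ?_⟩
    · rcases List.mem_cons.1 hD with rfl | hD
      · exact ⟨L, hC, by simp⟩
      · obtain ⟨L', hL', hsub⟩ := ih.1 D hD
        exact ⟨L', hL', fun x hx ↦ by simpa using Or.inr (by simpa using hsub hx)⟩
    · rw [List.flatten_cons, List.mem_append] at hC'
      rcases hC' with hC' | hC'
      · exact ⟨C, List.mem_cons_self, L, hC, hC'⟩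
      · obtain ⟨D, hD, h⟩ := ih.2 C' hC'
        exact ⟨D, List.mem_cons_of_mem _ hD, h⟩

/-- A level-`h` component tolerates `h` deletions, so chains at level `h + 1` start from the bound
`c = h + 1`. Separators are new, with exactly `h + 1` edges, or inherited and smaller; all have
fewer than `k` edges. -/
lemma HierarchicalDecomposition.exists_placed (D : HierarchicalDecomposition G s t k)
    (hV : V(G).Finite) (hE : E(G).Finite) (hG : TwoEdgeConnected G) (hs : s ∈ V(G))
    (ht : t ∈ V(G)) {h : ℕ} (h1 : 1 ≤ h) (hk : h ≤ k - 1) :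
    ∀ C ∈ D.level h, ∃ U W, Placed G s t C U W ∧ WellLinked G C (h + 1) ∧
      C.leftSep.ncard ≤ h ∧ C.rightSep.ncard ≤ h := by
  induction h, h1 using Nat.le_induction with
  | base =>
    intro C hC
    obtain rfl : C = rootComponent G s t := by simpa [D.level_one] using hC
    exact ⟨∅, ∅, placed_rootComponent, hG.wellLinked hs ht, by simp [rootComponent]⟩
  | succ h h1 ih =>
    intro C' hC'
    obtain ⟨chains, hchains, heq⟩ := D.level_succ h h1 (by omega)
    rw [heq] at hC'
    obtain ⟨C, hC, L, hL, hC'⟩ := (exists_chain_of_mem hchains).2 C' hC'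
    obtain ⟨U, W, hp, hwl, hl, hr⟩ := ih (by omega) C hC
    obtain ⟨U', W', hp', hwl', href⟩ := (hL.refines hV hE (by omega) hp hwl).2 C' hC'
    refine ⟨U', W', hp', hwl', ?_, ?_⟩
    · rcases href.left with ⟨-, h, -⟩ | ⟨-, h, -⟩
      · rw [h]; omega
      · exact h.le
    · rcases href.right with ⟨-, h, -⟩ | ⟨-, h, -⟩
      · rw [h]; omega
      · exact h.le

lemma demandValue_left_right {C : Component α β} {U W : Set α} (hE : E(G).Finite)
    (hp : Placed G s t C U W) : demandValue G k C C.left C.right = k := by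
  have h1 := hp.toLeft.missedEdges_left
  have h2 : missedEdges G C.rightSep C.right = ∅ := hp.toRight.missedEdges_left
  have h3 : ∀ n, n < demandValue G k C C.left C.right ↔ n < k := fun n ↦ by
    rw [lt_demandValue_iff hE hp, h1, h2]
    simp
  exact le_antisymm (not_lt.1 fun h ↦ lt_irrefl _ ((h3 _).1 h))
    (not_lt.1 fun h ↦ lt_irrefl _ ((h3 _).2 h))

lemma SatisfiesDemand.mono {X Y : Set α} {d d' : ℕ} (h : SatisfiesDemand G H X Y d)
    (hd : d' ≤ d) : SatisfiesDemand G H X Y d' :=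
  fun F hF hlt ↦ h F hF (hlt.trans_le hd)

lemma HierarchicalDecomposition.satisfiesDemand (D : HierarchicalDecomposition G s t k)
    (hV : V(G).Finite) (hE : E(G).Finite) (hG : TwoEdgeConnected G) (hs : s ∈ V(G))
    (ht : t ∈ V(G)) (hH : H ≤s G) (hsep : D.separatorEdges ⊆ E(H))
    (hdem : ∀ h : ℕ, 1 ≤ h → h ≤ k - 1 → ∀ C ∈ D.level h,
      (∀ X ⊆ C.left, ∀ Y ⊆ C.right, (X, Y) ≠ (C.left, C.right) →
        SatisfiesDemand (G.induce C.verts) (H.induce C.verts) X Y (demandValue G k C X Y)) ∧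
      SatisfiesDemand (G.induce C.verts) (H.induce C.verts) C.left C.right (h + 1))
    {h : ℕ} (h1 : 1 ≤ h) (hk : h ≤ k - 1) :
    ∀ C ∈ D.level h, SatisfiesDemand (G.induce C.verts) (H.induce C.verts) C.left C.right k := by
  refine Nat.decreasingInduction'
    (P := fun h ↦ ∀ C ∈ D.level h,
      SatisfiesDemand (G.induce C.verts) (H.induce C.verts) C.left C.right k)
    (fun h hlt hle ih C hC ↦ ?_) hk fun C hC ↦ ?_
  · obtain ⟨chains, hchains, heq⟩ := D.level_succ h (h1.trans hle) hlt
    obtain ⟨L, hL, hsub⟩ := (exists_chain_of_mem hchains).1 C hC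
    obtain ⟨U, W, hp, hwl, -⟩ := D.exists_placed hV hE hG hs ht (h1.trans hle) hlt.le C hC
    have hLD : ∀ C' ∈ L, C' ∈ D.level (h + 1) := fun C' hC' ↦ heq ▸ hsub hC'
    refine hL.satisfiesDemand hH hV hE (by omega) hp hwl
      (hdem h (h1.trans hle) hlt.le C hC).2 (fun C' hC' ↦ ⟨fun e he ↦ hsep
        ⟨h + 1, by omega, by omega, C', hLD C' hC', Or.inl he⟩, fun e he ↦ hsep
        ⟨h + 1, by omega, by omega, C', hLD C' hC', Or.inr he⟩⟩) fun C' hC' X hX Y hY ↦ ?_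
    by_cases hXY : (X, Y) = (C'.left, C'.right)
    · obtain ⟨rfl, rfl⟩ := Prod.mk.inj hXY
      obtain ⟨U', W', hp', -⟩ :=
        D.exists_placed hV hE hG hs ht (by omega) (by omega) C' (hLD C' hC')
      rw [demandValue_left_right hE hp']
      exact ih C' (hLD C' hC')
    · exact (hdem (h + 1) (by omega) (by omega) C' (hLD C' hC')).1 X hX Y hY hXY
  -- At the deepest level `h + 1 = k`, so demand 2 is already the claim.
  · exact (hdem (k - 1) (h1.trans hk) le_rfl C hC).2.mono (by omega)

end Hierarchy

end RSND

theorem mainTheorem3 {α β : Type*} (G : Graph α β) (hV : V(G).Finite) (hE : E(G).Finite)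
    (hG : RSND.TwoEdgeConnected G) (s t : α) (hs : s ∈ V(G)) (ht : t ∈ V(G))
    (k : ℕ) (hk : 2 ≤ k) (D : RSND.HierarchicalDecomposition G s t k)
    (H : Graph α β) (hH : H ≤s G) :
    RSND.IsFeasibleSD G H s t k ↔
      D.separatorEdges ⊆ E(H) ∧
      ∀ h : ℕ, 1 ≤ h → h ≤ k - 1 → ∀ C ∈ D.level h,
        (∀ X ⊆ C.left, ∀ Y ⊆ C.right, (X, Y) ≠ (C.left, C.right) →
          RSND.SatisfiesDemand (G.induce C.verts) (H.induce C.verts) X Y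
            (RSND.demandValue G k C X Y)) ∧
        RSND.SatisfiesDemand (G.induce C.verts) (H.induce C.verts) C.left C.right (h + 1) ∧
        RSND.SatisfiesDemand (G.induce C.verts) (H.induce C.verts) C.left C.right (k - 1) := by
  constructor
  · intro hfeas
    refine ⟨?_, fun h h1 hhk C hC ↦ ?_⟩
    · rintro e ⟨h, h1, hhk, C, hC, he⟩
      obtain ⟨U, W, hp, hwl, hl, hr⟩ := D.exists_placed hV hE hG hs ht h1 hhk C hC
      rcases he with he | he
      · exact hfeas.leftSep_subset hH hE hp hwl (by omega) he
      · exact hfeas.symm.leftSep_subset hH hE hp.symm hwl.symm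
          (show C.rightSep.ncard < k by omega) he
    · obtain ⟨U, W, hp, hwl, -⟩ := D.exists_placed hV hE hG hs ht h1 hhk C hC
      have hdem : ∀ X ⊆ C.left, ∀ Y ⊆ C.right,
          RSND.SatisfiesDemand (G.induce C.verts) (H.induce C.verts) X Y
            (RSND.demandValue G k C X Y) := fun X hX Y hY F hF hlt ↦
        hfeas.linked hH hp hwl hX hY hF ((RSND.lt_demandValue_iff hE hp).1 hlt)
      have hfull := hdem _ subset_rfl _ subset_rfl
      rw [RSND.demandValue_left_right hE hp] at hfull
      exact ⟨fun X hX Y hY _ ↦ hdem X hX Y hY, hfull.mono (by omega), hfull.mono (by omega)⟩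
  · rintro ⟨hsep, hdem⟩ F hF hlt hr
    have := D.satisfiesDemand hV hE hG hs ht hH hsep
      (fun h h1 hhk C hC ↦ ⟨(hdem h h1 hhk C hC).1, (hdem h h1 hhk C hC).2.1⟩) le_rfl
      (show 1 ≤ k - 1 by omega) (RSND.rootComponent G s t) (by simp [D.level_one]) F
    have hHV : H.induce V(G) = H := by rw [← hH.vertexSet_eq, Graph.induce_vertexSet]
    simp only [RSND.rootComponent, Graph.induce_vertexSet, hHV] at this
    obtain ⟨x, rfl, y, rfl, hxy⟩ := this hF hlt ⟨s, rfl, t, rfl, hr⟩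
    exact hxy
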